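/- A measurable quadratic differential $q=q(z)\,dz^2$ on $\mathbb{C}$ is given by a measurable function $q:\mathbb{C}\to\mathbb{C}$. Write $\|q\|_U=\int_U|q(z)|\,dx\,dy$. Its pull-back by a holomorphic map $M$ is $M^*q=q(M(z))M'(z)^2\,dz^2$, and its push-forward by cosine is $$\cos_*q=\Big(\sum_{z\in\cos^{-1}(w)}\frac{q(z)}{\sin^2 z}\Big)dw^2 .$$ A sequence $(q_n)$ of measurable quadratic differentials is *cos-efficient* if $\|q_n\|_{\mathbb{C}}\neq 0$ for all $n$ and $\|\cos_*q_n\|_{\mathbb{C}}/\|q_n\|_{\mathbb{C}}\to 1$. A sequence $(q_n)$ of measurable quadratic differentials with $0<\|q_n\|_{\mathbb{C}}<\infty$ for all $n$, for which $\lim_{n}\|q_n\|_{\mathbb{C}}$ exists and is finite and non-zero, *has limit model $dz^2/z^2$ on the annuli* $\{z : r_n<|z-b_n|<R_n\}$ (where $0<r_n<R_n$ and $b_n\in\mathbb{C}$) if $R_n/r_n\to\infty$ and there are $c_n\in\mathbb{C}\setminus\{0\}$ such that, with $M_n(z)=z+b_n$, $$\lim_{n\to\infty}\Big\|M_n^*q_n-c_n\frac{dz^2}{z^2}\Big|_{\{r_n<|z|<R_n\}}\Big\|_{\mathbb{C}}=0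 .$$ **Proposition.** Let $(q_n)$ be a cos-efficient sequence of measurable quadratic differentials on $\mathbb{C}$ that has limit model $dz^2/z^2$ on the annuli $A_n=\{z : r_n<|z-b_n|<R_n\}$. Then: 1. There is a sequence $R_n^*\in(r_n,R_n)$ with $R_n^*\to 0$ such that, with $A_n^*=\{z : r_n<|z-b_n|<R_n^*\}$, $\|q_n\|_{A_n^*}/\|q_n\|_{A_n}\to 1$. 2. Let $(R_n^*)$ be any sequence as in 1. If the centers $b_n$ do not approach the critical points of cosine, that is, if there is $\delta>0$ with $|b_n-k\pi|\ge\delta$ for all $k\in\mathbb{Z}$ and all sufficiently large $n$, then, after discarding finitely many $n$, the sequence $(\cos_*q_n)$ has limit model $dz^2/z^2$ on the annuli $$\{z : |\sin b_n|\,r_n<|z-\cos b_n|<|\sin b_n|\,R_n^*\}.$$ -/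

import Mathlib

open Filter Topology MeasureTheory

/-!
A measurable quadratic differential `q = q(z) dz²` on the plane is represented by its coefficient
function `q : ℂ → ℂ` in the global coordinate `z`.
-/

namespace QuadDiff

/-- The mass of `q` on `U`, that is, the integral over `U` of `|q(z)| dx dy`. -/
noncomputable def mass (q : ℂ → ℂ) (U : Set ℂ) : ENNReal :=
  ∫⁻ z in U, ‖q z‖ₑ

/-- The pull-back `M^* q = q(M(z)) M'(z)² dz²`. -/
noncomputable def pullback (M : ℂ → ℂ) (q : ℂ → ℂ) : ℂ → ℂ :=
  fun z => q (M z) * deriv M z ^ 2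

/-- The push-forward (direct image) `f_* q`: its coefficient at `w` is the sum of
`q(z) / f'(z)²` over all preimages `z` of `w`. For `f = cos` the denominators are `sin² z`; for
integrable `q` the series converges absolutely at almost every `w`. -/
noncomputable def pushforward (f : ℂ → ℂ) (q : ℂ → ℂ) : ℂ → ℂ :=
  fun w => ∑' z : f ⁻¹' {w}, q z / deriv f z ^ 2

/-- The open round annulus with center `b`, inner radius `r` and outer radius `R`. -/
def annulus (b : ℂ) (r R : ℝ) : Set ℂ :=
  {z | r < ‖z - b‖ ∧ ‖z - b‖ < R}

/-- The quadratic differential `c dz² / z²` restricted to `r < |z| < R` (and zero elsewhere). -/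
noncomputable def annularModel (c : ℂ) (r R : ℝ) : ℂ → ℂ :=
  (annulus 0 r R).indicator fun z => c / z ^ 2

/-- A sequence of measurable quadratic differentials of nonzero mass is cos-efficient if its
push-forwards under the cosine have asymptotically the same mass. -/
def CosEfficient (q : ℕ → ℂ → ℂ) : Prop :=
  (∀ n, AEStronglyMeasurable (q n) volume) ∧
  (∀ n, mass (q n) Set.univ ≠ 0) ∧
  Tendsto (fun n => mass (pushforward Complex.cos (q n)) Set.univ / mass (q n) Set.univ)
    atTop (𝓝 1)

/-- The sequence `q` has limit model `dz² / z²` on the annuli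
`r n < |z - b n| < R n`. The first three conditions are the standing assumptions on the sequence:
every `q n` is measurable with finite positive mass, and the masses have a (finite) nonzero
limit. -/
def HasAnnularLimitModel (q : ℕ → ℂ → ℂ) (b : ℕ → ℂ) (r R : ℕ → ℝ) : Prop :=
  (∀ n, AEStronglyMeasurable (q n) volume) ∧
  (∀ n, 0 < mass (q n) Set.univ ∧ mass (q n) Set.univ < ⊤) ∧
  (∃ β : NNReal, β ≠ 0 ∧ Tendsto (fun n => mass (q n) Set.univ) atTop (𝓝 (β : ENNReal))) ∧
  (∀ n, 0 < r n ∧ r n < R n) ∧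
  ∃ c : ℕ → ℂ, (∀ n, c n ≠ 0) ∧
    Tendsto (fun n => R n / r n) atTop atTop ∧
    Tendsto
      (fun n => mass (pullback (fun z => z + b n) (q n) - annularModel (c n) (r n) (R n)) Set.univ)
      atTop (𝓝 0)

/-- The outer radii `R n` may be shrunk to `S n`, tending to zero, such that asymptotically all of
the mass that `q n` has on the annulus `r n < |z - b n| < R n` lies on the subannulus
`r n < |z - b n| < S n`. -/
def ConcentratesOn (q : ℕ → ℂ → ℂ) (b : ℕ → ℂ) (r R S : ℕ → ℝ) : Prop :=
  (∀ n, S n ∈ Set.Ioo (r n) (R n)) ∧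
  Tendsto S atTop (𝓝 0) ∧
  Tendsto (fun n => mass (q n) (annulus (b n) (r n) (S n)) / mass (q n) (annulus (b n) (r n) (R n)))
    atTop (𝓝 1)

/-- The points `b n` do not approach the set of critical points `k π` of the cosine, not even along
a subsequence. -/
def StaysAwayFromCriticalPoints (b : ℕ → ℂ) : Prop :=
  ∃ δ : ℝ, 0 < δ ∧ ∀ᶠ n in atTop, ∀ k : ℤ, δ ≤ ‖b n - (k : ℂ) * (Real.pi : ℂ)‖

end QuadDiff

namespace QuadDiff

/-! Write `m n` for the model `c n dz²/(z - b n)²` on the annulus. Its mass is `2π ‖c n‖ log (R n /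
r n)`, it tends to a limit `β > 0`, and the ratio of the radii tends to infinity, so `c n → 0`. The
push-forward is an L¹ contraction (`mass_pushforward_cos_le`), so `q n` may be replaced by `m n`
throughout, and mass lost on one piece of a differential cannot be regained elsewhere
(`mass_pushforward_cos_add_sum_le`).

Shrinking the radii: the cosine has period `2π`, so the push-forward of `q` is also that of the
average of `q` and any translate by a period. On the dyadic annulus `πm < |z - b| < 2πm` the
translation by `2πm` makes the model overlap itself with different arguments, and partial
cancellation follows. By scale invariance of `dz²/z²` the loss is at least `η ‖c‖` with `η > 0`
independent of `m`. Summing over the dyadic annuli outside radius `r + π`, efficiency forces the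
positive part of `‖c n‖ log (R n / (r n + π))` to tend to `0` (`tendsto_max_mul_log_zero`). Thus the
mass concentrates inside radius `r n + π`; since `c n → 0`, this needs `r n → 0`, and the outer
radius can be lowered to `0` at negligible cost in logarithmic scale (`exists_shrunk_radii`).

Pushing forward: on a small disk away from the critical points the cosine is injective and close to
an affine map of derivative `-sin b`, which preserves the form `c dz²/z²`. The error has mass at
most `B ‖c‖` uniformly in `b` and in the radii (`exists_mass_pushforward_cos_modelAt_sub_le`), hence
tends to `0`. -/

/-! ### Fundamental domains of the cosine -/

/-- The open vertical strip `k π < re z < (k + 1) π`. -/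
def cosStrip (k : ℤ) : Set ℂ := {z | k * Real.pi < z.re ∧ z.re < (k + 1) * Real.pi}

lemma isOpen_cosStrip (k : ℤ) : IsOpen (cosStrip k) :=
  (isOpen_lt continuous_const Complex.continuous_re).inter
    (isOpen_lt Complex.continuous_re continuous_const)

lemma int_eq_zero_of_mul_pi_lt {m : ℤ} {x : ℝ} (hx : x = m * Real.pi) (h : |x| < Real.pi) :
    m = 0 := by
  rw [hx, abs_mul, abs_of_pos Real.pi_pos] at h
  have h1 : |(m : ℝ)| < 1 := by
    by_contra hc
    push Not at hc
    nlinarith [Real.pi_pos]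
  have h2 : |m| < 1 := by exact_mod_cast h1
  simpa using h2

lemma injOn_cos_cosStrip (k : ℤ) : Set.InjOn Complex.cos (cosStrip k) := by
  intro x hx y hy hxy
  obtain ⟨m, h | h⟩ := Complex.cos_eq_cos_iff.1 hxy
  · have hre : y.re - x.re = (2 * m : ℤ) * Real.pi := by
      rw [h]; simp
    have := int_eq_zero_of_mul_pi_lt hre (by
      rw [abs_lt]; constructor <;> nlinarith [hx.1, hx.2, hy.1, hy.2])
    have hm : m = 0 := by omega
    simp [h, hm]
  · have hre : y.re + x.re - (2 * k + 1) * Real.pi = (2 * m - 2 * k - 1 : ℤ) * Real.pi := by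
      rw [h]; push_cast; simp; ring
    have := int_eq_zero_of_mul_pi_lt hre (by
      rw [abs_lt]; constructor <;> nlinarith [hx.1, hx.2, hy.1, hy.2])
    omega

lemma eq_of_mem_cosStrip {j k : ℤ} {z : ℂ} (hj : z ∈ cosStrip j) (hk : z ∈ cosStrip k) :
    j = k := by
  have h1 : (j : ℝ) < k + 1 := by
    have := hj.1.trans hk.2
    exact lt_of_mul_lt_mul_right this Real.pi_pos.le
  have h2 : (k : ℝ) < j + 1 := by
    have := hk.1.trans hj.2
    exact lt_of_mul_lt_mul_right this Real.pi_pos.le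
  have h3 : j < k + 1 := by exact_mod_cast h1
  have h4 : k < j + 1 := by exact_mod_cast h2
  omega

lemma volume_re_eq (a : ℝ) : volume {z : ℂ | z.re = a} = 0 := by
  have h := Complex.volume_preserving_equiv_real_prod
  have h2 : {z : ℂ | z.re = a} = Complex.measurableEquivRealProd ⁻¹' ({a} ×ˢ Set.univ) := by
    ext z; simp [Complex.measurableEquivRealProd]
  rw [h2, h.measure_preimage_equiv, Measure.volume_eq_prod, Measure.prod_prod]
  simp

lemma volume_compl_iUnion_cosStrip : volume (⋃ k, cosStrip k)ᶜ = 0 := by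
  have hsub : (⋃ k, cosStrip k)ᶜ ⊆ ⋃ k : ℤ, {z : ℂ | z.re = k * Real.pi} := by
    intro z hz
    simp only [Set.mem_compl_iff, Set.mem_iUnion, not_exists] at hz
    refine Set.mem_iUnion.2 ⟨⌊z.re / Real.pi⌋, ?_⟩
    have h1 := Int.floor_le (z.re / Real.pi)
    have h2 := Int.lt_floor_add_one (z.re / Real.pi)
    rw [le_div_iff₀ Real.pi_pos] at h1
    rw [div_lt_iff₀ Real.pi_pos] at h2
    by_contra hne
    exact hz _ ⟨lt_of_le_of_ne h1 (fun h => hne h.symm), h2⟩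
  exact measure_mono_null hsub (measure_iUnion_null fun k => volume_re_eq _)

/-- Differentiable maps send null sets to null sets. This allows a.e. modifications of a function
inside sums over fibers. -/
lemma ae_forall_cos_eq {P : ℂ → Prop} (h : ∀ᵐ z, P z) :
    ∀ᵐ w, ∀ z, Complex.cos z = w → P z := by
  have h0 := addHaar_image_eq_zero_of_differentiableOn_of_addHaar_eq_zero volume
    (f := Complex.cos) (s := {z | ¬ P z})
    ((Complex.differentiable_cos.restrictScalars ℝ).differentiableOn) h
  rw [ae_iff]
  refine measure_mono_null ?_ h0
  intro w hw
  simp only [Set.mem_ofPred_eq, not_forall] at hw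
  obtain ⟨z, hz, hP⟩ := hw
  exact ⟨z, hP, hz⟩

/-! ### Sums over the fibers of the cosine -/

/-- The function `g` on the strip `cosStrip k`, transported to the plane by the cosine, and
extended by zero. -/
noncomputable def branch {E : Type*} [Zero E] (k : ℤ) (g : ℂ → E) : ℂ → E :=
  Function.extend (fun z : cosStrip k => Complex.cos z) (fun z : cosStrip k => g z) 0

lemma injective_cos_cosStrip (k : ℤ) :
    Function.Injective (fun z : cosStrip k => Complex.cos z) :=
  fun x y h => Subtype.ext (injOn_cos_cosStrip k x.2 y.2 h)

lemma branch_cos {E : Type*} [Zero E] {k : ℤ} (g : ℂ → E) {z : ℂ} (hz : z ∈ cosStrip k) :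
    branch k g (Complex.cos z) = g z :=
  (injective_cos_cosStrip k).extend_apply (fun z : cosStrip k => g z) 0 ⟨z, hz⟩

lemma branch_of_notMem {E : Type*} [Zero E] {k : ℤ} (g : ℂ → E) {w : ℂ}
    (hw : w ∉ Complex.cos '' cosStrip k) : branch k g w = 0 := by
  refine Function.extend_apply' _ _ _ ?_
  rintro ⟨z, hz⟩
  exact hw ⟨z, z.2, hz⟩

lemma measurable_branch {E : Type*} [Zero E] [MeasurableSpace E] (k : ℤ) {g : ℂ → E}
    (hg : Measurable g) : Measurable (branch k g) := by
  have := ContinuousOn.measurableEmbedding (isOpen_cosStrip k).measurableSet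
    Complex.continuous_cos.continuousOn (injOn_cos_cosStrip k)
  exact this.measurable_extend (hg.comp measurable_subtype_coe) measurable_const

/-- Each strip meets a fiber at most once, and almost every fiber avoids the lines between strips.
The new index set `ℤ` does not depend on `w`, which gives access to measurability and to termwise
integration; the exceptional set does not depend on `g`. -/
lemma ae_tsum_fiber_eq_tsum_branch {E : Type*} [AddCommMonoid E] [TopologicalSpace E] :
    ∀ᵐ w, ∀ g : ℂ → E, ∑' z : Complex.cos ⁻¹' {w}, g z = ∑' k, branch k g w := by
  have h0 : ∀ᵐ z : ℂ, ∃ k, z ∈ cosStrip k := by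
    rw [ae_iff]
    convert volume_compl_iUnion_cosStrip using 2
    ext z; simp
  filter_upwards [ae_forall_cos_eq h0] with w hw g
  choose ι hι using fun z : Complex.cos ⁻¹' {w} => hw z z.2
  have hinj : Function.Injective ι := by
    intro x y hxy
    have hx := hι x
    rw [hxy] at hx
    exact Subtype.ext (injOn_cos_cosStrip _ hx (hι y)
      ((show Complex.cos x = w from x.2).trans (show Complex.cos y = w from y.2).symm))
  rw [← hinj.tsum_eq (f := fun k => branch k g w)]
  · refine tsum_congr fun z => ?_
    have hz : Complex.cos z = w := z.2
    rw [← branch_cos g (hι z), hz]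
  · intro k hk
    by_contra hc
    apply hk
    refine branch_of_notMem g ?_
    rintro ⟨z, hz, hzw⟩
    exact hc ⟨⟨z, hzw⟩, eq_of_mem_cosStrip (hι _) hz⟩

lemma ofReal_abs_det_smulRight (a : ℂ) :
    ENNReal.ofReal |((ContinuousLinearMap.toSpanSingleton ℂ a).restrictScalars ℝ).det| =
      ‖a‖ₑ ^ 2 := by
  have h : ((ContinuousLinearMap.toSpanSingleton ℂ a).restrictScalars ℝ).det = ‖a‖ ^ 2 := by
    simp [ContinuousLinearMap.det, LinearMap.det_restrictScalars, Algebra.norm_complex_apply,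
      Complex.normSq_eq_norm_sq]
  rw [h, abs_of_nonneg (by positivity), ENNReal.ofReal_pow (norm_nonneg _), ofReal_norm]

lemma lintegral_image_of_hasDerivAt {f f' : ℂ → ℂ} {s : Set ℂ} (hs : MeasurableSet s)
    (hf : ∀ z ∈ s, HasDerivAt f (f' z) z) (hinj : Set.InjOn f s) (g : ℂ → ENNReal) :
    ∫⁻ w in f '' s, g w = ∫⁻ z in s, ‖f' z‖ₑ ^ 2 * g (f z) := by
  rw [lintegral_image_eq_lintegral_abs_det_fderiv_mul volume hs
    (fun z hz => ((hf z hz).hasFDerivAt.restrictScalars ℝ).hasFDerivWithinAt) hinj]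
  simp_rw [ofReal_abs_det_smulRight]

lemma lintegral_branch (k : ℤ) (h : ℂ → ENNReal) :
    ∫⁻ w, branch k h w = ∫⁻ z in cosStrip k, ‖Complex.sin z‖ₑ ^ 2 * h z := by
  have h1 : ∫⁻ w, branch k h w = ∫⁻ w in Complex.cos '' cosStrip k, branch k h w := by
    refine (setLIntegral_eq_of_support_subset ?_).symm
    intro w hw
    by_contra hc
    exact hw (branch_of_notMem h hc)
  rw [h1, lintegral_image_of_hasDerivAt (isOpen_cosStrip k).measurableSet
    (fun z _ => Complex.hasDerivAt_cos z) (injOn_cos_cosStrip k)]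
  refine setLIntegral_congr_fun (isOpen_cosStrip k).measurableSet fun z hz => ?_
  simp [branch_cos h hz]

/-- Change of variables on each strip; `‖sin z‖²` is the real Jacobian of the cosine, and it cancels
the denominator when `h` is the modulus of `q / sin²`. -/
lemma lintegral_tsum_fiber {h : ℂ → ENNReal} (hh : AEMeasurable h) :
    ∫⁻ w, ∑' z : Complex.cos ⁻¹' {w}, h z = ∫⁻ z, ‖Complex.sin z‖ₑ ^ 2 * h z := by
  have h1 : ∫⁻ w, ∑' z : Complex.cos ⁻¹' {w}, h z = ∫⁻ w, ∑' k, branch k (hh.mk h) w := by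
    refine lintegral_congr_ae ?_
    filter_upwards [ae_tsum_fiber_eq_tsum_branch (E := ENNReal),
      ae_forall_cos_eq hh.ae_eq_mk] with w hw hw'
    rw [← hw]
    exact tsum_congr fun z => hw' z z.2
  rw [h1, lintegral_tsum fun k => (measurable_branch k hh.measurable_mk).aemeasurable]
  simp_rw [lintegral_branch]
  rw [← lintegral_iUnion (fun k => (isOpen_cosStrip k).measurableSet)
    (fun i j hij => Set.disjoint_left.2 fun z hz hz' => hij (eq_of_mem_cosStrip hz hz'))]
  rw [Measure.restrict_congr_set (ae_eq_univ.2 volume_compl_iUnion_cosStrip), Measure.restrict_univ]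
  refine lintegral_congr_ae ?_
  filter_upwards [hh.ae_eq_mk] with z hz
  rw [hz]

/-! ### The push-forward by the cosine -/

lemma mass_mono {q : ℂ → ℂ} {U V : Set ℂ} (h : U ⊆ V) : mass q U ≤ mass q V :=
  lintegral_mono_set h

lemma mass_add_le {q p : ℂ → ℂ} (hq : AEStronglyMeasurable q volume) (U : Set ℂ) :
    mass (q + p) U ≤ mass q U + mass p U := by
  unfold mass
  rw [← lintegral_add_left' hq.enorm.restrict]
  exact lintegral_mono fun z => enorm_add_le _ _

lemma mass_congr_ae {q p : ℂ → ℂ} (h : q =ᵐ[volume] p) (U : Set ℂ) : mass q U = mass p U := by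
  refine lintegral_congr_ae (ae_restrict_of_ae ?_)
  filter_upwards [h] with z hz
  rw [hz]

lemma mass_sub_comm (q p : ℂ → ℂ) (U : Set ℂ) : mass (q - p) U = mass (p - q) U := by
  unfold mass
  refine lintegral_congr fun z => ?_
  simp [← edist_eq_enorm_sub, edist_comm]

lemma mass_le_mass_sub_add {q p : ℂ → ℂ} (hp : AEStronglyMeasurable p volume) (U : Set ℂ) :
    mass q U ≤ mass p U + mass (q - p) U := by
  have := mass_add_le (p := q - p) hp U
  simpa using this

lemma mass_indicator {q : ℂ → ℂ} {A : Set ℂ} (hA : MeasurableSet A) :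
    mass (A.indicator q) Set.univ = mass q A := by
  unfold mass
  rw [Measure.restrict_univ, ← lintegral_indicator hA]
  simp_rw [enorm_indicator_eq_indicator_enorm]

lemma pushforward_cos_apply (q : ℂ → ℂ) (w : ℂ) :
    pushforward Complex.cos q w =
      ∑' z : Complex.cos ⁻¹' {w}, q z / Complex.sin z ^ 2 := by
  simp [pushforward]

lemma enorm_sin_sq_mul_le (q : ℂ → ℂ) (z : ℂ) :
    ‖Complex.sin z‖ₑ ^ 2 * ‖q z / Complex.sin z ^ 2‖ₑ ≤ ‖q z‖ₑ := by
  rw [← enorm_pow, ← enorm_mul]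
  -- Equality can fail at zeros of the sine, where the quotient takes the default value `0`.
  by_cases h : Complex.sin z = 0
  · simp [h]
  · rw [mul_div_cancel₀]
    exact pow_ne_zero 2 h

lemma aestronglyMeasurable_div_sin_sq {q : ℂ → ℂ} (hq : AEStronglyMeasurable q volume) :
    AEStronglyMeasurable (fun z => q z / Complex.sin z ^ 2) volume :=
  (hq.aemeasurable.div
    ((Complex.continuous_sin.measurable.pow_const 2).aemeasurable)).aestronglyMeasurable

lemma lintegral_tsum_enorm_le {q : ℂ → ℂ} (hq : AEStronglyMeasurable q volume) :
    ∫⁻ w, ∑' z : Complex.cos ⁻¹' {w}, ‖q z / Complex.sin z ^ 2‖ₑ ≤ mass q Set.univ := by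
  rw [lintegral_tsum_fiber (h := fun z => ‖q z / Complex.sin z ^ 2‖ₑ)
    (aestronglyMeasurable_div_sin_sq hq).enorm, mass, Measure.restrict_univ]
  exact lintegral_mono fun z => enorm_sin_sq_mul_le q z

/-- The push-forward does not increase the mass. -/
lemma mass_pushforward_cos_le {q : ℂ → ℂ} (hq : AEStronglyMeasurable q volume) :
    mass (pushforward Complex.cos q) Set.univ ≤ mass q Set.univ := by
  refine le_trans ?_ (lintegral_tsum_enorm_le hq)
  rw [mass, Measure.restrict_univ]
  refine lintegral_mono fun w => ?_
  rw [pushforward_cos_apply]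
  exact enorm_tsum_le_tsum_enorm

/-- A function of finite integral is finite a.e. Summability is what makes the push-forward additive
a.e., as a divergent `tsum` has the default value `0`. -/
lemma ae_summable_fiber {q : ℂ → ℂ} (hq : AEStronglyMeasurable q volume)
    (hfin : mass q Set.univ < ⊤) :
    ∀ᵐ w, Summable fun z : Complex.cos ⁻¹' {w} => q z / Complex.sin z ^ 2 := by
  have hm : AEMeasurable
      (fun w => ∑' z : Complex.cos ⁻¹' {w}, ‖q z / Complex.sin z ^ 2‖ₑ) volume := by
    set h := fun z => ‖q z / Complex.sin z ^ 2‖ₑ with hdef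
    have hh : AEMeasurable h := (aestronglyMeasurable_div_sin_sq hq).enorm
    refine AEMeasurable.congr (f := fun w => ∑' k, branch k (hh.mk h) w)
      (AEMeasurable.tsum fun k => (measurable_branch k hh.measurable_mk).aemeasurable) ?_
    filter_upwards [ae_tsum_fiber_eq_tsum_branch (E := ENNReal),
      ae_forall_cos_eq hh.ae_eq_mk] with w hw hw'
    rw [← hw]
    exact tsum_congr fun z => (hw' z z.2).symm
  have h2 := ae_lt_top' hm ((lintegral_tsum_enorm_le hq).trans_lt hfin).ne
  filter_upwards [h2] with w hw
  refine Summable.of_norm ?_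
  have := ENNReal.tsum_coe_ne_top_iff_summable.1 (by simpa [enorm] using hw.ne)
  simpa using (NNReal.summable_coe.2 this)

/-- The push-forward is an a.e. limit of finite sums over strips, each of which is measurable for a
measurable representative of `q / sin²`. -/
lemma aestronglyMeasurable_pushforward_cos {q : ℂ → ℂ} (hq : AEStronglyMeasurable q volume)
    (hfin : mass q Set.univ < ⊤) :
    AEStronglyMeasurable (pushforward Complex.cos q) volume := by
  set g := fun z => q z / Complex.sin z ^ 2 with hg
  have hgm : AEStronglyMeasurable g volume := aestronglyMeasurable_div_sin_sq hq
  have hmeas : ∀ k, Measurable (branch k (hgm.mk g)) := fun k =>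
    measurable_branch k hgm.stronglyMeasurable_mk.measurable
  have hfib := ae_tsum_fiber_eq_tsum_branch (E := ℂ)
  have hfib' := ae_tsum_fiber_eq_tsum_branch (E := ENNReal)
  have hlim : ∀ᵐ w, Tendsto (fun s : Finset ℤ => ∑ k ∈ s, branch k (hgm.mk g) w) atTop
      (𝓝 (pushforward Complex.cos q w)) := by
    have hsum : ∀ᵐ w, Summable fun k => branch k (hgm.mk g) w := by
      have hm : AEMeasurable (fun w => ∑' k, branch k (fun z => ‖hgm.mk g z‖ₑ) w) volume :=
        AEMeasurable.tsum fun k =>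
          (measurable_branch k hgm.stronglyMeasurable_mk.measurable.enorm).aemeasurable
      have hint : ∫⁻ w, ∑' k, branch k (fun z => ‖hgm.mk g z‖ₑ) w ≠ ⊤ := by
        refine ne_top_of_le_ne_top hfin.ne (le_trans (le_of_eq ?_) (lintegral_tsum_enorm_le hq))
        refine lintegral_congr_ae ?_
        filter_upwards [hfib', ae_forall_cos_eq hgm.ae_eq_mk] with w hw hw'
        rw [← hw]
        exact tsum_congr fun z => by rw [← hw' z z.2]
      filter_upwards [ae_lt_top' hm hint] with w hw
      refine Summable.of_norm ?_
      have key : ∀ k, branch k (fun z => ‖hgm.mk g z‖ₑ) w = ‖branch k (hgm.mk g) w‖ₑ := by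
        intro k
        by_cases hk : w ∈ Complex.cos '' cosStrip k
        · obtain ⟨z, hz, rfl⟩ := hk
          simp [branch_cos _ hz]
        · simp [branch_of_notMem _ hk]
      simp_rw [key] at hw
      have := ENNReal.tsum_coe_ne_top_iff_summable.1 (by simpa [enorm] using hw.ne)
      simpa using (NNReal.summable_coe.2 this)
    filter_upwards [hfib, hsum, ae_forall_cos_eq hgm.ae_eq_mk] with w h1 h2 h3
    have h4 : pushforward Complex.cos q w = ∑' k, branch k (hgm.mk g) w := by
      rw [pushforward_cos_apply, ← h1]
      exact tsum_congr fun z => h3 z z.2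
    rw [h4]
    exact h2.hasSum
  exact aestronglyMeasurable_of_tendsto_ae atTop
    (fun s => (Finset.measurable_fun_sum s fun k _ => hmeas k).aestronglyMeasurable) hlim

lemma pushforward_cos_add_ae {q p : ℂ → ℂ} (hq : AEStronglyMeasurable q volume)
    (hqfin : mass q Set.univ < ⊤) (hp : AEStronglyMeasurable p volume)
    (hpfin : mass p Set.univ < ⊤) :
    pushforward Complex.cos (q + p) =ᵐ[volume]
      pushforward Complex.cos q + pushforward Complex.cos p := by
  filter_upwards [ae_summable_fiber hq hqfin, ae_summable_fiber hp hpfin] with w h1 h2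
  simp only [Pi.add_apply, pushforward_cos_apply, add_div]
  exact h1.tsum_add h2

lemma pushforward_cos_sub_ae {q p : ℂ → ℂ} (hq : AEStronglyMeasurable q volume)
    (hqfin : mass q Set.univ < ⊤) (hp : AEStronglyMeasurable p volume)
    (hpfin : mass p Set.univ < ⊤) :
    pushforward Complex.cos (q - p) =ᵐ[volume]
      pushforward Complex.cos q - pushforward Complex.cos p := by
  filter_upwards [ae_summable_fiber hq hqfin, ae_summable_fiber hp hpfin] with w h1 h2
  simp only [Pi.sub_apply, pushforward_cos_apply, sub_div]
  exact h1.tsum_sub h2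

lemma mass_pushforward_cos_sub_le {q p : ℂ → ℂ} (hq : AEStronglyMeasurable q volume)
    (hqfin : mass q Set.univ < ⊤) (hp : AEStronglyMeasurable p volume)
    (hpfin : mass p Set.univ < ⊤) :
    mass (pushforward Complex.cos q - pushforward Complex.cos p) Set.univ ≤
      mass (q - p) Set.univ := by
  rw [← mass_congr_ae (pushforward_cos_sub_ae hq hqfin hp hpfin)]
  exact mass_pushforward_cos_le (hq.sub hp)

lemma mass_pushforward_cos_add_le {q p : ℂ → ℂ} (hq : AEStronglyMeasurable q volume)
    (hqfin : mass q Set.univ < ⊤) (hp : AEStronglyMeasurable p volume)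
    (hpfin : mass p Set.univ < ⊤) :
    mass (pushforward Complex.cos (q + p)) Set.univ ≤
      mass (pushforward Complex.cos q) Set.univ + mass (pushforward Complex.cos p) Set.univ := by
  rw [mass_congr_ae (pushforward_cos_add_ae hq hqfin hp hpfin)]
  exact mass_add_le (aestronglyMeasurable_pushforward_cos hq hqfin) _

lemma pushforward_cos_comp_add_two_pi (q : ℂ → ℂ) (m : ℤ) :
    pushforward Complex.cos (fun z => q (z + m * (2 * Real.pi))) = pushforward Complex.cos q := by
  ext w
  rw [pushforward_cos_apply, pushforward_cos_apply]
  let e : Complex.cos ⁻¹' {w} ≃ Complex.cos ⁻¹' {w} :=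
    { toFun := fun z => ⟨z + m * (2 * Real.pi), by
        have : Complex.cos z = w := z.2
        simp [Complex.cos_add_int_mul_two_pi, this]⟩
      invFun := fun z => ⟨z - m * (2 * Real.pi), by
        have : Complex.cos z = w := z.2
        simp [Complex.cos_sub_int_mul_two_pi, this]⟩
      left_inv := fun z => by simp
      right_inv := fun z => by simp }
  rw [← e.tsum_eq fun z => q z / Complex.sin z ^ 2]
  refine tsum_congr fun z => ?_
  simp [e, Complex.sin_add_int_mul_two_pi]

lemma mass_const_mul (a : ℂ) (q : ℂ → ℂ) (U : Set ℂ) :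
    mass (fun z => a * q z) U = ‖a‖ₑ * mass q U := by
  simp_rw [mass, enorm_mul]
  rw [lintegral_const_mul' _ _ enorm_ne_top]

/-- The push-forward of `q` is not larger than the average of `q` and a translate of `q` by a
period of the cosine. -/
lemma mass_pushforward_cos_le_of_translate {q : ℂ → ℂ} (hq : AEStronglyMeasurable q volume)
    (hfin : mass q Set.univ < ⊤) (m : ℤ) :
    2 * mass (pushforward Complex.cos q) Set.univ ≤
      mass (fun z => q z + q (z + m * (2 * Real.pi))) Set.univ := by
  set t : ℂ := m * (2 * Real.pi)
  have hT : MeasurePreserving (fun z : ℂ => z + t) volume volume :=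
    measurePreserving_add_right volume t
  have hq' : AEStronglyMeasurable (fun z => q (z + t)) volume :=
    hq.comp_measurePreserving hT
  have hfin' : mass (fun z => q (z + t)) Set.univ < ⊤ := by
    refine lt_of_eq_of_lt ?_ hfin
    simp only [mass, Measure.restrict_univ]
    exact lintegral_add_right_eq_self (fun z => ‖q z‖ₑ) t
  -- The push-forward of this sum is twice that of `q`, so the contraction property bounds it by a
  -- mass in which `q` may cancel against its translate.
  have h := mass_pushforward_cos_le (hq.add hq')
  rw [mass_congr_ae (pushforward_cos_add_ae hq hfin hq' hfin'),
    pushforward_cos_comp_add_two_pi] at h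
  refine le_trans (le_of_eq ?_) h
  have h2 := mass_const_mul 2 (pushforward Complex.cos q) Set.univ
  have h3 : (‖(2 : ℂ)‖ₑ) = 2 := by
    rw [← ofReal_norm]; simp
  rw [h3] at h2
  rw [← h2]
  congr 1
  ext w
  simp [two_mul]

lemma mass_add_mass_compl (q : ℂ → ℂ) {U : Set ℂ} (hU : MeasurableSet U) :
    mass q U + mass q Uᶜ = mass q Set.univ := by
  simp only [mass, Measure.restrict_univ]
  exact lintegral_add_compl _ hU

/-- Whatever mass is lost in the push-forwards of the restrictions of `q` to disjoint sets is also
lost in the push-forward of `q`. -/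
lemma mass_pushforward_cos_add_sum_le {ι : Type*} {q : ℂ → ℂ}
    (hq : AEStronglyMeasurable q volume) (hfin : mass q Set.univ < ⊤) (s : Finset ι)
    {A : ι → Set ℂ} (hA : ∀ i, MeasurableSet (A i))
    (hdisj : Pairwise (Function.onFun Disjoint A)) :
    mass (pushforward Complex.cos q) Set.univ + ∑ i ∈ s, mass q (A i) ≤
      mass q Set.univ + ∑ i ∈ s, mass (pushforward Complex.cos ((A i).indicator q)) Set.univ := by
  classical
  have hind : ∀ {B : Set ℂ}, MeasurableSet B → AEStronglyMeasurable (B.indicator q) volume ∧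
      mass (B.indicator q) Set.univ < ⊤ := fun {B} hB =>
    ⟨hq.indicator hB, by
      rw [mass_indicator hB]; exact (mass_mono (Set.subset_univ _)).trans_lt hfin⟩
  have hU : ∀ s : Finset ι, MeasurableSet (⋃ i ∈ s, A i) := fun s =>
    s.measurableSet_biUnion fun i _ => hA i
  have hunion : ∀ s : Finset ι, mass (pushforward Complex.cos ((⋃ i ∈ s, A i).indicator q))
      Set.univ ≤ ∑ i ∈ s, mass (pushforward Complex.cos ((A i).indicator q)) Set.univ := by
    intro s
    induction s using Finset.induction_on with
    | empty =>
      refine (mass_pushforward_cos_le (hind (hU ∅)).1).trans ?_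
      simp [mass]
    | insert a s ha ih =>
      have hd : Disjoint (A a) (⋃ i ∈ s, A i) := by
        simp only [Set.disjoint_iUnion_right]
        exact fun i hi => hdisj (by rintro rfl; exact ha hi)
      rw [Finset.set_biUnion_insert, Set.indicator_union_of_disjoint hd, Finset.sum_insert ha]
      refine (mass_pushforward_cos_add_le (hind (hA a)).1 (hind (hA a)).2
        (hind (hU s)).1 (hind (hU s)).2).trans ?_
      gcongr
  have h1 := mass_pushforward_cos_add_le (hind (hU s)).1 (hind (hU s)).2
    (hind (hU s).compl).1 (hind (hU s).compl).2
  rw [Set.indicator_self_add_compl] at h1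
  have h2 : mass q (⋃ i ∈ s, A i) = ∑ i ∈ s, mass q (A i) :=
    lintegral_biUnion_finset (fun i _ j _ hij => hdisj hij) (fun i _ => hA i) _
  -- Outside the union only the contraction property is used. Losses are expressed by adding masses
  -- on both sides, avoiding truncated subtraction.
  calc _ ≤ (∑ i ∈ s, mass (pushforward Complex.cos ((A i).indicator q)) Set.univ +
        mass q (⋃ i ∈ s, A i)ᶜ) + mass q (⋃ i ∈ s, A i) := by
        rw [h2]
        gcongr
        refine h1.trans ?_
        gcongr
        · exact hunion s
        · refine (mass_pushforward_cos_le (hind (hU s).compl).1).trans_eq ?_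
          rw [mass_indicator (hU s).compl]
    _ = _ := by
        rw [← mass_add_mass_compl q (hU s)]
        ring

/-! ### The model differential -/

lemma lintegral_norm {F : ℝ → ENNReal} (hF : Measurable F) :
    ∫⁻ z : ℂ, F ‖z‖ =
      (∫⁻ x in Set.Ioi (0 : ℝ), ENNReal.ofReal x * F x) * ENNReal.ofReal (2 * Real.pi) := by
  rw [← Complex.lintegral_comp_polarCoord_symm, polarCoord_target, Measure.volume_eq_prod,
    ← Measure.prod_restrict]
  have h1 : ∫⁻ _ in Set.Ioo (-Real.pi) Real.pi, (1 : ENNReal) = ENNReal.ofReal (2 * Real.pi) := by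
    simp [two_mul]
  rw [← h1, ← lintegral_prod_mul (by fun_prop) (by fun_prop), Measure.prod_restrict]
  refine setLIntegral_congr_fun (measurableSet_Ioi.prod measurableSet_Ioo) fun p hp => ?_
  simp only [Complex.norm_polarCoord_symm, abs_of_pos (Set.mem_Ioi.1 hp.1), smul_eq_mul, mul_one]

lemma measurableSet_annulus (b : ℂ) (r R : ℝ) : MeasurableSet (annulus b r R) := by
  have h : annulus b r R = (fun z => ‖z - b‖) ⁻¹' Set.Ioo r R := rfl
  rw [h]
  exact (show Measurable fun z : ℂ => ‖z - b‖ by fun_prop) measurableSet_Ioo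

/-- The quadratic differential `c dz² / (z - b)²` restricted to `r < |z - b| < R`. -/
noncomputable def modelAt (c b : ℂ) (r R : ℝ) : ℂ → ℂ :=
  (annulus b r R).indicator fun z => c / (z - b) ^ 2

lemma modelAt_eq (c b : ℂ) (r R : ℝ) (z : ℂ) :
    modelAt c b r R z = annularModel c r R (z - b) := by
  have h : z ∈ annulus b r R ↔ z - b ∈ annulus 0 r R := by simp [annulus]
  by_cases hz : z ∈ annulus b r R
  · rw [modelAt, annularModel, Set.indicator_of_mem hz, Set.indicator_of_mem (h.1 hz)]
  · rw [modelAt, annularModel, Set.indicator_of_notMem hz,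
      Set.indicator_of_notMem fun h' => hz (h.2 h')]

lemma measurable_modelAt (c b : ℂ) (r R : ℝ) : Measurable (modelAt c b r R) :=
  Measurable.indicator (by fun_prop) (measurableSet_annulus b r R)

lemma mass_pullback_sub (q : ℂ → ℂ) (c b : ℂ) (r R : ℝ) :
    mass (pullback (fun z => z + b) q - annularModel c r R) Set.univ =
      mass (q - modelAt c b r R) Set.univ := by
  simp only [mass, Measure.restrict_univ]
  rw [← lintegral_add_right_eq_self (fun z => ‖(q - modelAt c b r R) z‖ₑ) b]
  simp [pullback, modelAt_eq]

lemma mass_modelAt (c b : ℂ) {r R : ℝ} (hr : 0 < r) (hR : r ≤ R) :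
    mass (modelAt c b r R) Set.univ = ENNReal.ofReal (‖c‖ * (2 * Real.pi * Real.log (R / r))) := by
  have h1 : mass (modelAt c b r R) Set.univ = ∫⁻ z : ℂ, (Set.Ioo r R).indicator
      (fun x => ENNReal.ofReal (‖c‖ / x ^ 2)) ‖z‖ := by
    rw [mass, Measure.restrict_univ, ← lintegral_add_right_eq_self _ b]
    refine lintegral_congr fun z => ?_
    have h : z + b ∈ annulus b r R ↔ ‖z‖ ∈ Set.Ioo r R := by simp [annulus]
    by_cases hz : ‖z‖ ∈ Set.Ioo r R
    · rw [modelAt, Set.indicator_of_mem (h.2 hz), Set.indicator_of_mem hz, ← ofReal_norm]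
      simp
    · rw [modelAt, Set.indicator_of_notMem fun h' => hz (h.1 h'), Set.indicator_of_notMem hz,
        enorm_zero]
  have hsub : Set.Ioo r R ⊆ Set.Ioi 0 := fun x hx => hr.trans hx.1
  have h2 : ∫⁻ x in Set.Ioi (0 : ℝ), ENNReal.ofReal x * (Set.Ioo r R).indicator
      (fun x => ENNReal.ofReal (‖c‖ / x ^ 2)) x = ENNReal.ofReal (‖c‖ * Real.log (R / r)) := by
    calc _ = ∫⁻ x in Set.Ioi (0 : ℝ), (Set.Ioo r R).indicator
          (fun x => ENNReal.ofReal (‖c‖ * (1 / x))) x := by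
          refine setLIntegral_congr_fun measurableSet_Ioi fun x hx => ?_
          have hx' : x ≠ 0 := (Set.mem_Ioi.1 hx).ne'
          by_cases h : x ∈ Set.Ioo r R
          · simp only [Set.indicator_of_mem h]
            rw [← ENNReal.ofReal_mul (le_of_lt hx)]
            congr 1
            field_simp
          · simp [Set.indicator_of_notMem h]
      _ = ∫⁻ x in Set.Ioc r R, ENNReal.ofReal (‖c‖ * (1 / x)) := by
          rw [lintegral_indicator measurableSet_Ioo, Measure.restrict_restrict measurableSet_Ioo,
            Set.inter_eq_left.2 hsub]
          exact setLIntegral_congr Ioo_ae_eq_Ioc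
      _ = ENNReal.ofReal (∫ x in r..R, ‖c‖ * (1 / x)) := by
          rw [intervalIntegral.integral_of_le hR, ofReal_integral_eq_lintegral_ofReal]
          · rw [← IntegrableOn, ← intervalIntegrable_iff_integrableOn_Ioc_of_le hR]
            refine ContinuousOn.intervalIntegrable fun x hx => ContinuousAt.continuousWithinAt ?_
            rw [Set.uIcc_of_le hR] at hx
            have hx' : x ≠ 0 := (hr.trans_le hx.1).ne'
            fun_prop (disch := assumption)
          · filter_upwards [ae_restrict_mem measurableSet_Ioc] with x hx
            have := hr.trans hx.1
            simp only [Pi.zero_apply]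
            positivity
      _ = _ := by
          rw [intervalIntegral.integral_const_mul, integral_one_div_of_pos hr (hr.trans_le hR)]
  rw [h1, lintegral_norm (Measurable.indicator (by fun_prop) measurableSet_Ioo), h2,
    ← ENNReal.ofReal_mul (mul_nonneg (norm_nonneg _) (Real.log_nonneg ((one_le_div hr).2 hR)))]
  congr 1
  ring

lemma indicator_annulus_modelAt (c b : ℂ) {r R r' R' : ℝ} (hr : r ≤ r') (hR : R' ≤ R) :
    (annulus b r' R').indicator (modelAt c b r R) = modelAt c b r' R' := by
  rw [modelAt, Set.indicator_indicator, modelAt]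
  congr 1
  exact Set.inter_eq_left.2 fun z hz => ⟨hr.trans_lt hz.1, hz.2.trans_le hR⟩

lemma mass_modelAt_annulus (c b : ℂ) {r R r' R' : ℝ} (hr : 0 < r') (hR : r' ≤ R')
    (hrr : r ≤ r') (hRR : R' ≤ R) : mass (modelAt c b r R) (annulus b r' R') =
      ENNReal.ofReal (‖c‖ * (2 * Real.pi * Real.log (R' / r'))) := by
  rw [← mass_indicator (measurableSet_annulus b r' R'), indicator_annulus_modelAt c b hrr hRR,
    mass_modelAt c b hr hR]

/-- Twice the mass of the average of the model differential on `1 < |z| < 2` and its translate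
by `2`. -/
noncomputable def translateMass : ENNReal :=
  mass (fun z => modelAt 1 0 1 2 z + modelAt 1 0 1 2 (z + 2)) Set.univ

/-- The triangle inequality is strict on a set of positive measure. -/
lemma translateMass_lt :
    translateMass < 2 * ENNReal.ofReal (2 * Real.pi * Real.log 2) := by
  have hκ := mass_modelAt 1 0 one_pos one_le_two
  simp only [norm_one, one_mul, div_one] at hκ
  have hmeas : Measurable (modelAt 1 0 1 2) := measurable_modelAt _ _ _ _
  have hg : ∫⁻ z : ℂ, (‖modelAt 1 0 1 2 z‖ₑ + ‖modelAt 1 0 1 2 (z + 2)‖ₑ) =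
      2 * ENNReal.ofReal (2 * Real.pi * Real.log 2) := by
    rw [lintegral_add_left hmeas.enorm,
      lintegral_add_right_eq_self (fun z => ‖modelAt 1 0 1 2 z‖ₑ) (2 : ℂ), ← hκ, mass,
      Measure.restrict_univ, two_mul]
  rw [← hg, translateMass, mass, Measure.restrict_univ]
  have hne : ∫⁻ z : ℂ, ‖modelAt 1 0 1 2 z + modelAt 1 0 1 2 (z + 2)‖ₑ ≠ ⊤ := by
    refine ne_top_of_le_ne_top ?_ (lintegral_mono fun z => enorm_add_le _ _)
    rw [hg]
    exact ENNReal.mul_ne_top (by simp) ENNReal.ofReal_ne_top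
  refine lintegral_strict_mono_of_ae_le_of_ae_lt_on (s := {z | ‖modelAt 1 0 1 2 z +
    modelAt 1 0 1 2 (z + 2)‖ₑ < ‖modelAt 1 0 1 2 z‖ₑ + ‖modelAt 1 0 1 2 (z + 2)‖ₑ}) ?_ hne
    (Eventually.of_forall fun z => enorm_add_le _ _) ?_ (Eventually.of_forall fun z hz => hz)
  · exact (hmeas.enorm.add (hmeas.comp (measurable_add_const 2)).enorm).aemeasurable
  -- Both `z₀` and `z₀ + 2` have modulus `√2`, inside the annulus, and their squares are `-2i` and
  -- `2i`: the two terms cancel exactly at `z₀`, and strictness persists nearby by continuity.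
  set z₀ : ℂ := -1 + Complex.I with hz₀
  have hn : ‖z₀‖ = √2 := by
    rw [hz₀, Complex.norm_def]; congr 1; simp [Complex.normSq_apply]; norm_num
  have hn' : ‖z₀ + 2‖ = √2 := by
    rw [hz₀, Complex.norm_def]; congr 1; simp [Complex.normSq_apply]; norm_num
  have hs1 : 1 < √2 := Real.lt_sqrt_of_sq_lt (by norm_num)
  have hs2 : √2 < 2 := by rw [Real.sqrt_lt' (by norm_num)]; norm_num
  have hz0 : z₀ ≠ 0 := by rw [← norm_pos_iff, hn]; positivity
  have hz2 : z₀ + 2 ≠ 0 := by rw [← norm_pos_iff, hn']; positivity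
  refine (Measure.measure_pos_of_mem_nhds volume (x := z₀) ?_).ne'
  have hc1 : ContinuousAt (fun z : ℂ => ‖z‖) z₀ := by fun_prop
  have hc2 : ContinuousAt (fun z : ℂ => ‖z + 2‖) z₀ := by fun_prop
  have hi1 : ContinuousAt (fun z : ℂ => 1 / z ^ 2) z₀ := by fun_prop (disch := simpa using hz0)
  have hi2 : ContinuousAt (fun z : ℂ => 1 / (z + 2) ^ 2) z₀ := by
    fun_prop (disch := simpa using hz2)
  have hlt := (hi1.add hi2).norm.eventually_lt (hi1.norm.add hi2.norm) (by
    have e1 : z₀ ^ 2 = -(2 * Complex.I) := by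
      rw [hz₀]; ring_nf; rw [Complex.I_sq]; ring
    have e2 : (z₀ + 2) ^ 2 = 2 * Complex.I := by
      rw [hz₀]; ring_nf; rw [Complex.I_sq]; ring
    show ‖1 / z₀ ^ 2 + 1 / (z₀ + 2) ^ 2‖ < ‖1 / z₀ ^ 2‖ + ‖1 / (z₀ + 2) ^ 2‖
    rw [e1, e2]
    simp)
  filter_upwards [hlt, hc1.eventually_const_lt (hn ▸ hs1), hc1.eventually_lt_const (hn ▸ hs2),
    hc2.eventually_const_lt (hn' ▸ hs1), hc2.eventually_lt_const (hn' ▸ hs2)] with z h h1 h2 h3 h4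
  have hA : z ∈ annulus 0 1 2 := by simp only [annulus, sub_zero]; exact ⟨h1, h2⟩
  have hB : z + 2 ∈ annulus 0 1 2 := by simp only [annulus, sub_zero]; exact ⟨h3, h4⟩
  simp only [modelAt, Set.indicator_of_mem hA, Set.indicator_of_mem hB, sub_zero]
  rw [← ofReal_norm, ← ofReal_norm, ← ofReal_norm, ← ENNReal.ofReal_add (norm_nonneg _)
    (norm_nonneg _)]
  exact (ENNReal.ofReal_lt_ofReal_iff_of_nonneg (norm_nonneg _)).2 h

/-- Scale invariance of `dz²/z²`: the substitution `z = b + ρζ` reduces to the unit annulus and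
turns the shift `2ρ` into `2`. -/
lemma mass_modelAt_add_translate (c b : ℂ) {ρ : ℝ} (hρ : 0 < ρ) :
    mass (fun z => modelAt c b ρ (2 * ρ) z + modelAt c b ρ (2 * ρ) (z + 2 * ρ)) Set.univ =
      ‖c‖ₑ * translateMass := by
  have hρ' : (ρ : ℂ) ≠ 0 := by exact_mod_cast hρ.ne'
  have hscale : ∀ z, modelAt c b ρ (2 * ρ) (b + ρ * z) = c / ρ ^ 2 * modelAt 1 0 1 2 z := by
    intro z
    have hmem : b + ρ * z ∈ annulus b ρ (2 * ρ) ↔ z ∈ annulus 0 1 2 := by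
      simp only [annulus, Set.mem_ofPred_eq, add_sub_cancel_left, norm_mul, Complex.norm_real,
        Real.norm_eq_abs, abs_of_pos hρ, sub_zero]
      rw [lt_mul_iff_one_lt_right hρ, mul_comm 2 ρ, mul_lt_mul_iff_right₀ hρ]
    by_cases h : z ∈ annulus 0 1 2
    · simp only [modelAt, Set.indicator_of_mem h, Set.indicator_of_mem (hmem.2 h)]
      rw [add_sub_cancel_left, mul_pow, sub_zero, div_mul_div_comm, mul_one]
    · simp only [modelAt, Set.indicator_of_notMem h, Set.indicator_of_notMem (fun h' => h (hmem.1 h')),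
        mul_zero]
  have himage : (fun z : ℂ => b + ρ * z) '' Set.univ = Set.univ := by
    rw [Set.image_univ, Set.range_eq_univ]
    intro w
    exact ⟨(w - b) / ρ, by field_simp; ring⟩
  rw [translateMass, ← mass_const_mul]
  simp only [mass]
  conv_lhs => rw [← himage]
  rw [lintegral_image_of_hasDerivAt (f' := fun _ => (ρ : ℂ)) MeasurableSet.univ
    (fun z _ => by simpa using ((hasDerivAt_id z).const_mul (ρ : ℂ)).const_add b)
    (fun x _ y _ h => by simpa [hρ'] using h)]
  refine lintegral_congr fun z => ?_
  have h2 : b + ρ * z + 2 * ρ = b + ρ * (z + 2) := by ring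
  rw [h2, hscale, hscale, ← mul_add, ← enorm_pow, ← enorm_mul]
  congr 1
  field_simp

/-- On dyadic annuli whose radii are multiples of `π`, the push-forward of the model differential
loses a definite proportion of the mass. -/
lemma mass_pushforward_cos_modelAt_le (c b : ℂ) {m : ℕ} (hm : 0 < m) :
    2 * mass (pushforward Complex.cos (modelAt c b (Real.pi * m) (2 * (Real.pi * m)))) Set.univ ≤
      ‖c‖ₑ * translateMass := by
  have hpos : 0 < Real.pi * m := by positivity
  -- With inner radius `πm` the shift by twice this radius is `m` periods of the cosine.
  rw [← mass_modelAt_add_translate c b hpos]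
  refine (mass_pushforward_cos_le_of_translate (measurable_modelAt _ _ _ _).aestronglyMeasurable
    ?_ m).trans_eq ?_
  · rw [mass_modelAt _ _ hpos (by linarith)]
    exact ENNReal.ofReal_lt_top
  · congr 1
    ext z
    congr 3
    push_cast
    ring

lemma dyadic_annuli_disjoint (b : ℂ) {ρ : ℝ} (hρ : 0 < ρ) :
    Pairwise (Function.onFun Disjoint
      fun j : ℕ => annulus b (ρ * 2 ^ j) (2 * (ρ * 2 ^ j))) := by
  have key : ∀ i j : ℕ, i < j → ∀ z, z ∈ annulus b (ρ * 2 ^ i) (2 * (ρ * 2 ^ i)) →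
      z ∈ annulus b (ρ * 2 ^ j) (2 * (ρ * 2 ^ j)) → False := by
    intro i j hij z hi hj
    have h1 : (2 : ℝ) ^ (i + 1) ≤ 2 ^ j := pow_le_pow_right₀ one_le_two hij
    have h2 := hi.2
    have h3 := hj.1
    have : ρ * 2 ^ (i + 1) ≤ ρ * 2 ^ j := by gcongr
    rw [pow_succ] at this
    linarith
  intro i j hij
  refine Set.disjoint_left.2 fun z hi hj => ?_
  rcases lt_or_gt_of_ne hij with h | h
  · exact key i j h z hi hj
  · exact key j i h z hj hi

/-- The push-forward of the model differential loses mass proportional to the number of dyadic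
annuli contained in the part of the annulus outside the disk of radius `r + π`. -/
lemma exists_mass_pushforward_cos_modelAt_loss : ∃ η : ℝ, 0 < η ∧ ∀ (c b : ℂ) (r R : ℝ), 0 < r →
    r < R → ENNReal.ofReal (‖c‖ * (η * (Real.log (R / (r + Real.pi)) / Real.log 2 - 1))) +
      mass (pushforward Complex.cos (modelAt c b r R)) Set.univ ≤
        mass (modelAt c b r R) Set.univ := by
  have hlt := translateMass_lt
  set κ := ENNReal.ofReal (2 * Real.pi * Real.log 2) with hκ
  have hκtop : κ ≠ ⊤ := ENNReal.ofReal_ne_top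
  have hTtop : translateMass ≠ ⊤ := hlt.ne_top
  -- For `c = 1`, a dyadic annulus has mass `κ` and its push-forward at most `translateMass / 2`;
  -- `η` is the guaranteed loss.
  set η := (κ - translateMass / 2).toReal with hη
  have hlt' : translateMass / 2 < κ := by
    rw [ENNReal.div_lt_iff (by simp) (by simp), mul_comm]; exact hlt
  have hηpos : 0 < η := ENNReal.toReal_pos (tsub_pos_of_lt hlt').ne' (ne_top_of_le_ne_top hκtop tsub_le_self)
  have hηof : ENNReal.ofReal η + translateMass / 2 = κ := by
    rw [hη, ENNReal.ofReal_toReal (ne_top_of_le_ne_top hκtop tsub_le_self),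
      tsub_add_cancel_of_le hlt'.le]
  refine ⟨η, hηpos, fun c b r R hr hR => ?_⟩
  -- The least multiple of `π` that is at least `r`; it lies below `r + π`.
  set m := ⌈r / Real.pi⌉₊ with hm
  have hmpos : 0 < m := Nat.ceil_pos.2 (by positivity)
  have hm1 : r ≤ Real.pi * m := by
    have := Nat.le_ceil (r / Real.pi)
    rw [div_le_iff₀ Real.pi_pos] at this
    linarith
  have hm2 : Real.pi * m < r + Real.pi := by
    have := Nat.ceil_lt_add_one (a := r / Real.pi) (by positivity)
    rw [← hm] at this
    calc Real.pi * m < Real.pi * (r / Real.pi + 1) := by gcongr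
      _ = r + Real.pi := by field_simp
  have hρ : 0 < Real.pi * m := by positivity
  -- The number of successive dyadic annuli that fit between `πm` and `R`; rounding down costs the
  -- `- 1` in the statement.
  set J := ⌊Real.logb 2 (R / (Real.pi * m))⌋₊ with hJ
  have hJ1 : Real.log (R / (r + Real.pi)) / Real.log 2 - 1 ≤ J := by
    have h1 := Nat.lt_floor_add_one (Real.logb 2 (R / (Real.pi * m)))
    have h2 : Real.log (R / (r + Real.pi)) ≤ Real.log (R / (Real.pi * m)) := by
      have : 0 < R := hr.trans hR
      gcongr
    have h3 : Real.log (R / (r + Real.pi)) / Real.log 2 ≤ Real.logb 2 (R / (Real.pi * m)) := by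
      rw [Real.logb]
      gcongr
    rw [← hJ] at h1
    linarith
  have hsub : ∀ j < J, 2 * (Real.pi * m * 2 ^ j) ≤ R := by
    intro j hj
    have h1 : (J : ℝ) ≤ Real.logb 2 (R / (Real.pi * m)) := by
      refine Nat.floor_le ?_
      have := (Nat.zero_le j).trans_lt hj
      exact (zero_le_one.trans (Nat.floor_pos.1 this))
    rw [Real.le_logb_iff_rpow_le one_lt_two (div_pos (hr.trans hR) hρ), Real.rpow_natCast,
      le_div_iff₀ hρ] at h1
    have h2 : (2 : ℝ) ^ (j + 1) ≤ 2 ^ J := pow_le_pow_right₀ one_le_two hj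
    calc 2 * (Real.pi * m * 2 ^ j) = 2 ^ (j + 1) * (Real.pi * m) := by ring
      _ ≤ 2 ^ J * (Real.pi * m) := by gcongr
      _ ≤ R := h1
  have hin : ∀ j : ℕ, r ≤ Real.pi * m * 2 ^ j := fun j =>
    hm1.trans (le_mul_of_one_le_right hρ.le (one_le_pow₀ one_le_two))
  have hfin : mass (modelAt c b r R) Set.univ < ⊤ := by
    rw [mass_modelAt c b hr hR.le]; exact ENNReal.ofReal_lt_top
  have hmain := mass_pushforward_cos_add_sum_le
    (measurable_modelAt c b r R).aestronglyMeasurable hfin (Finset.range J)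
    (fun j => measurableSet_annulus b (Real.pi * m * 2 ^ j) (2 * (Real.pi * m * 2 ^ j)))
    (dyadic_annuli_disjoint b hρ)
  have hS1 : ∀ j ∈ Finset.range J, mass (modelAt c b r R)
      (annulus b (Real.pi * m * 2 ^ j) (2 * (Real.pi * m * 2 ^ j))) = ‖c‖ₑ * κ := by
    intro j hj
    have hp : 0 < Real.pi * m * 2 ^ j := by positivity
    rw [mass_modelAt_annulus c b hp (by linarith) (hin j) (hsub j (Finset.mem_range.1 hj)),
      mul_div_cancel_right₀ _ hp.ne', ENNReal.ofReal_mul (norm_nonneg _), ofReal_norm]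
  have hS2 : ∀ j ∈ Finset.range J, mass (pushforward Complex.cos
      ((annulus b (Real.pi * m * 2 ^ j) (2 * (Real.pi * m * 2 ^ j))).indicator
        (modelAt c b r R))) Set.univ ≤ ‖c‖ₑ * (translateMass / 2) := by
    intro j hj
    rw [indicator_annulus_modelAt c b (hin j) (hsub j (Finset.mem_range.1 hj)), ← mul_div_assoc,
      ENNReal.le_div_iff_mul_le (by simp) (by simp), mul_comm]
    have := mass_pushforward_cos_modelAt_le c b (m := m * 2 ^ j) (by positivity)
    push_cast at this
    rwa [← mul_assoc Real.pi] at this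
  rw [Finset.sum_congr rfl hS1, Finset.sum_const, Finset.card_range, nsmul_eq_mul, ← hηof] at hmain
  have hmain2 := hmain.trans (add_le_add_right (Finset.sum_le_card_nsmul _ _ _ hS2) _)
  rw [Finset.card_range, nsmul_eq_mul, mul_add, mul_add, ← add_assoc] at hmain2
  have hT : (J : ENNReal) * (‖c‖ₑ * (translateMass / 2)) ≠ ⊤ :=
    ENNReal.mul_ne_top (by simp) (ENNReal.mul_ne_top enorm_ne_top (hlt'.ne_top))
  have hmain3 := (ENNReal.add_le_add_iff_right hT).1 hmain2
  refine le_trans ?_ hmain3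
  rw [add_comm]
  gcongr
  calc ENNReal.ofReal (‖c‖ * (η * (Real.log (R / (r + Real.pi)) / Real.log 2 - 1)))
      ≤ ENNReal.ofReal (J * (‖c‖ * η)) := by
        refine ENNReal.ofReal_le_ofReal ?_
        calc ‖c‖ * (η * (Real.log (R / (r + Real.pi)) / Real.log 2 - 1)) ≤ ‖c‖ * (η * J) := by
              gcongr
          _ = _ := by ring
    _ = _ := by
      rw [ENNReal.ofReal_mul (by positivity), ENNReal.ofReal_mul (by positivity), ofReal_norm,
        ENNReal.ofReal_natCast]

/-! ### The cosine near a non-critical point -/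

/-- With `u = x + iy` the difference of `b` and a multiple of `π` nearest to its real part, `|sin
u|² = sin² x + sinh² y`; then use `|sin x| ≥ (2/π)|x|` for `|x| ≤ π/2` and `|sinh y| ≥ |y|`. -/
lemma le_norm_sin_of_forall_le_norm_sub {δ : ℝ} (hδ : 0 ≤ δ) {b : ℂ}
    (hb : ∀ k : ℤ, δ ≤ ‖b - (k : ℂ) * (Real.pi : ℂ)‖) :
    2 / Real.pi * δ ≤ ‖Complex.sin b‖ := by
  set k := round (b.re / Real.pi) with hk
  set u : ℂ := b - k * Real.pi with hu
  have hsin : ‖Complex.sin b‖ = ‖Complex.sin u‖ := by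
    have hcos : Complex.cos (k * Real.pi) = (((-1) ^ k : ℝ) : ℂ) := by
      rw [← Real.cos_int_mul_pi]
      push_cast
      rfl
    rw [hu, Complex.sin_sub, Complex.sin_int_mul_pi, hcos]
    simp
  have hre : |u.re| ≤ Real.pi / 2 := by
    have h1 := abs_sub_round (b.re / Real.pi)
    have h2 : u.re = Real.pi * (b.re / Real.pi - k) := by
      rw [hu, mul_sub, mul_div_cancel₀ _ Real.pi_ne_zero]
      simp [mul_comm]
    rw [h2, abs_mul, abs_of_pos Real.pi_pos]
    calc Real.pi * |b.re / Real.pi - k| ≤ Real.pi * (1 / 2) := by gcongr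
      _ = Real.pi / 2 := by ring
  have h1 : (2 / Real.pi * |u.re|) ^ 2 ≤ Real.sin u.re ^ 2 := by
    rw [← sq_abs (Real.sin _)]
    have := Real.mul_abs_le_abs_sin hre
    gcongr
  have h2 : u.im ^ 2 ≤ Real.sinh u.im ^ 2 := by
    rw [sq_le_sq, Real.abs_sinh]
    exact Real.self_le_sinh_iff.2 (abs_nonneg _)
  have hnorm : ‖Complex.sin u‖ ^ 2 = Real.sin u.re ^ 2 + Real.sinh u.im ^ 2 := by
    rw [← Complex.normSq_eq_norm_sq, Complex.sin_eq, Complex.normSq_apply]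
    simp only [← Complex.ofReal_sin, ← Complex.ofReal_cos, ← Complex.ofReal_sinh,
      ← Complex.ofReal_cosh, ← Complex.ofReal_mul]
    simp only [Complex.add_re, Complex.add_im, Complex.mul_re, Complex.mul_im, Complex.ofReal_re,
      Complex.ofReal_im, Complex.I_re, Complex.I_im]
    linear_combination Real.sinh u.im ^ 2 * Real.sin_sq_add_cos_sq u.re +
      Real.sin u.re ^ 2 * Real.cosh_sq u.im
  have hu2 : ‖u‖ ^ 2 = u.re ^ 2 + u.im ^ 2 := by
    rw [← Complex.normSq_eq_norm_sq, Complex.normSq_apply]; ring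
  have hδu : δ ^ 2 ≤ ‖u‖ ^ 2 := by
    have := hb k
    gcongr
  have hpi : 2 / Real.pi ≤ 1 := by
    rw [div_le_one Real.pi_pos]; linarith [Real.pi_gt_three]
  have hpi' : (2 / Real.pi) ^ 2 ≤ 1 := pow_le_one₀ (by positivity) hpi
  rw [hsin]
  refine le_of_sq_le_sq ?_ (norm_nonneg _)
  rw [hnorm, mul_pow]
  rw [mul_pow, sq_abs] at h1
  calc (2 / Real.pi) ^ 2 * δ ^ 2 ≤ (2 / Real.pi) ^ 2 * (u.re ^ 2 + u.im ^ 2) := by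
        rw [← hu2]; gcongr
    _ = (2 / Real.pi) ^ 2 * u.re ^ 2 + (2 / Real.pi) ^ 2 * u.im ^ 2 := by ring
    _ ≤ Real.sin u.re ^ 2 + 1 * u.im ^ 2 := by gcongr
    _ ≤ _ := by linarith

/-- The cotangent controls the nonlinearity of the cosine relative to its derivative at `b`. Its
bound makes the distortion estimates uniform in `b`, even for unbounded imaginary part. -/
lemma norm_cos_div_sin_le {s : ℝ} (hs : 0 < s) {b : ℂ} (hb : s ≤ ‖Complex.sin b‖) :
    ‖Complex.cos b / Complex.sin b‖ ≤ 1 + 1 / s := by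
  have h1 : ‖Complex.cos b‖ ^ 2 ≤ 1 + ‖Complex.sin b‖ ^ 2 := by
    rw [← norm_pow, ← norm_pow, Complex.cos_sq']
    exact (norm_sub_le _ _).trans_eq (by rw [norm_one])
  have h2 : ‖Complex.cos b‖ ≤ 1 + ‖Complex.sin b‖ := by
    refine le_of_sq_le_sq ?_ (by positivity)
    nlinarith [norm_nonneg (Complex.sin b)]
  rw [norm_div, div_le_iff₀ (hs.trans_le hb)]
  calc ‖Complex.cos b‖ ≤ 1 + ‖Complex.sin b‖ := h2
    _ ≤ ‖Complex.sin b‖ / s + ‖Complex.sin b‖ := by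
      gcongr
      exact (one_le_div hs).2 hb
    _ = _ := by ring

lemma norm_sin_sub_self_le {h : ℂ} (hh : ‖h‖ ≤ 1) : ‖Complex.sin h - h‖ ≤ ‖h‖ ^ 2 := by
  have h1 := Complex.norm_exp_sub_one_sub_id_le (x := -h * Complex.I) (by simpa using hh)
  have h2 := Complex.norm_exp_sub_one_sub_id_le (x := h * Complex.I) (by simpa using hh)
  have h3 : Complex.sin h - h = ((Complex.exp (-h * Complex.I) - 1 - -h * Complex.I) -
      (Complex.exp (h * Complex.I) - 1 - h * Complex.I)) * (Complex.I / 2) := by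
    rw [Complex.sin]
    linear_combination -h * Complex.I_sq
  have h4 := norm_sub_le (Complex.exp (-h * Complex.I) - 1 - -h * Complex.I)
    (Complex.exp (h * Complex.I) - 1 - h * Complex.I)
  simp only [norm_mul, norm_neg, Complex.norm_I, mul_one] at h1 h2
  rw [h3, norm_mul, norm_div, Complex.norm_I, Complex.norm_two]
  linarith

lemma norm_cos_sub_one_le {h : ℂ} (hh : ‖h‖ ≤ 1) : ‖Complex.cos h - 1‖ ≤ ‖h‖ ^ 2 := by
  have h1 := Complex.norm_exp_sub_one_sub_id_le (x := -h * Complex.I) (by simpa using hh)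
  have h2 := Complex.norm_exp_sub_one_sub_id_le (x := h * Complex.I) (by simpa using hh)
  have h3 : Complex.cos h - 1 = ((Complex.exp (h * Complex.I) - 1 - h * Complex.I) +
      (Complex.exp (-h * Complex.I) - 1 - -h * Complex.I)) / 2 := by
    rw [Complex.cos]
    ring
  have h4 := norm_add_le (Complex.exp (h * Complex.I) - 1 - h * Complex.I)
    (Complex.exp (-h * Complex.I) - 1 - -h * Complex.I)
  simp only [norm_mul, norm_neg, Complex.norm_I, mul_one] at h1 h2
  rw [h3, norm_div, Complex.norm_two]
  linarith

/-- The difference quotient bounds for the cosine, normalized by its derivative at `b`. -/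
lemma norm_normalized_cos_sub_le {C : ℝ} {b h : ℂ} (hb : Complex.sin b ≠ 0)
    (hC : ‖Complex.cos b / Complex.sin b‖ ≤ C) (hh : ‖h‖ ≤ 1) :
    ‖(Complex.cos b - Complex.cos (b + h)) / Complex.sin b - h‖ ≤ (1 + 2 * C) * ‖h‖ ^ 2 ∧
      ‖Complex.sin (b + h) / Complex.sin b - 1‖ ≤ (1 + 2 * C) * ‖h‖ := by
  have hs := norm_sin_sub_self_le hh
  have hc := norm_cos_sub_one_le hh
  have hC0 : 0 ≤ C := (norm_nonneg _).trans hC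
  have hsq : ‖h‖ ^ 2 ≤ ‖h‖ := by nlinarith [norm_nonneg h]
  constructor
  · have e : (Complex.cos b - Complex.cos (b + h)) / Complex.sin b - h =
        (Complex.sin h - h) - Complex.cos b / Complex.sin b * (Complex.cos h - 1) := by
      rw [Complex.cos_add]
      field_simp
      ring
    rw [e]
    calc _ ≤ ‖Complex.sin h - h‖ + ‖Complex.cos b / Complex.sin b‖ * ‖Complex.cos h - 1‖ := by
          rw [← norm_mul]; exact norm_sub_le _ _
      _ ≤ ‖h‖ ^ 2 + C * ‖h‖ ^ 2 := by gcongr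
      _ ≤ _ := by nlinarith [mul_nonneg hC0 (sq_nonneg ‖h‖)]
  · have e : Complex.sin (b + h) / Complex.sin b - 1 =
        (Complex.cos h - 1) + Complex.cos b / Complex.sin b * Complex.sin h := by
      rw [Complex.sin_add]
      field_simp
      ring
    have hs2 : ‖Complex.sin h‖ ≤ 2 * ‖h‖ := by
      have := norm_add_le (Complex.sin h - h) h
      rw [sub_add_cancel] at this
      linarith
    rw [e]
    calc _ ≤ ‖Complex.cos h - 1‖ + ‖Complex.cos b / Complex.sin b‖ * ‖Complex.sin h‖ := by
          rw [← norm_mul]; exact norm_add_le _ _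
      _ ≤ ‖h‖ + C * (2 * ‖h‖) := by
          gcongr
          linarith
      _ = _ := by ring

/-- Points with equal cosines differ by a multiple of `2π`, too long for the disk unless zero, or
have a critical point `kπ` as midpoint, which would then be within `ρ` of `b`. -/
lemma injOn_cos_closedBall {b : ℂ} {δ ρ : ℝ} (hb : ∀ k : ℤ, δ ≤ ‖b - (k : ℂ) * (Real.pi : ℂ)‖)
    (hρ : ρ < δ) (hρ1 : ρ ≤ 1) : Set.InjOn Complex.cos (Metric.closedBall b ρ) := by
  intro x hx y hy hxy
  rw [mem_closedBall_iff_norm] at hx hy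
  obtain ⟨k, h | h⟩ := Complex.cos_eq_cos_iff.1 hxy
  · have h1 : ‖(2 * k * Real.pi : ℂ)‖ ≤ 2 := by
      have : (2 * k * Real.pi : ℂ) = (y - b) - (x - b) := by rw [h]; ring
      rw [this]
      exact (norm_sub_le _ _).trans (by linarith)
    have h2 : |(k : ℝ)| * Real.pi ≤ 1 := by
      simp only [norm_mul, Complex.norm_two, Complex.norm_intCast, Complex.norm_real,
        Real.norm_eq_abs, abs_of_pos Real.pi_pos] at h1
      linarith
    have h3 : |(k : ℝ)| < 1 := by
      by_contra hc
      push Not at hc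
      nlinarith [Real.pi_gt_three]
    have h4 : |k| < 1 := by exact_mod_cast h3
    have h5 : k = 0 := by simpa using h4
    simp [h, h5]
  · have h1 : 2 * (b - k * Real.pi) = -((y - b) + (x - b)) := by rw [h]; ring
    have h2 : 2 * ‖b - k * Real.pi‖ ≤ 2 * ρ := by
      rw [← Complex.norm_two, ← norm_mul, h1, norm_neg, Complex.norm_two]
      exact (norm_add_le _ _).trans (by linarith)
    have := hb k
    linarith

/-- This presents a differential as the push-forward of its pull-back along one inverse branch, so
that comparisons downstairs follow from comparisons upstairs by contraction. -/
lemma pushforward_cos_indicator_mul {D : Set ℂ} (hinj : Set.InjOn Complex.cos D)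
    (hsin : ∀ z ∈ D, Complex.sin z ≠ 0) {p : ℂ → ℂ}
    (hp : Function.support p ⊆ Complex.cos '' D) :
    pushforward Complex.cos (D.indicator fun z => p (Complex.cos z) * Complex.sin z ^ 2) = p := by
  ext w
  rw [pushforward_cos_apply]
  by_cases hw : w ∈ Complex.cos '' D
  · obtain ⟨z, hz, hzw⟩ := hw
    rw [tsum_eq_single ⟨z, hzw⟩]
    · rw [Set.indicator_of_mem hz, hzw, mul_div_cancel_right₀]
      exact pow_ne_zero 2 (hsin z hz)
    · intro y hy
      rw [Set.indicator_of_notMem, zero_div]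
      intro hyD
      exact hy (Subtype.ext (hinj hyD hz ((show Complex.cos y = w from y.2).trans hzw.symm)))
  · have hpw : p w = 0 := by
      by_contra h
      exact hw (hp h)
    rw [hpw]
    refine (tsum_congr fun z => ?_).trans tsum_zero
    rw [Set.indicator_of_notMem, zero_div]
    exact fun hz => hw ⟨z, hz, z.2⟩

/-- Quantitative open mapping: on the circle of radius `ρ`, `cos z` stays at distance at least `‖sin
b‖ ρ / 2` from `cos b`, so the image of the disk contains the ball of half that radius. -/
lemma ball_subset_cos_image {b : ℂ} {C ρ S : ℝ} (hb : Complex.sin b ≠ 0)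
    (hC : ‖Complex.cos b / Complex.sin b‖ ≤ C) (hρ : 0 < ρ) (hρ1 : ρ ≤ 1)
    (hρC : (1 + 2 * C) * ρ ≤ 1 / 2) (hS : S ≤ ρ / 4) :
    Metric.ball (Complex.cos b) (‖Complex.sin b‖ * S) ⊆
      Complex.cos '' Metric.closedBall b ρ := by
  have hsb : 0 < ‖Complex.sin b‖ := norm_pos_iff.2 hb
  have hlow : ∀ z : ℂ, ‖z - b‖ ≤ ρ → ‖Complex.sin b‖ * ‖z - b‖ / 2 ≤
      ‖Complex.cos z - Complex.cos b‖ := by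
    intro z hz
    have h1 := (norm_normalized_cos_sub_le hb hC (hz.trans hρ1)).1
    rw [add_sub_cancel] at h1
    have h2 : ‖z - b‖ - ‖(Complex.cos b - Complex.cos z) / Complex.sin b‖ ≤
        (1 + 2 * C) * ‖z - b‖ ^ 2 := by
      refine le_trans ?_ h1
      rw [norm_sub_rev ((Complex.cos b - Complex.cos z) / Complex.sin b)]
      exact norm_sub_norm_le _ _
    have hC0 : 0 ≤ C := (norm_nonneg _).trans hC
    have h3 : (1 + 2 * C) * ‖z - b‖ ^ 2 ≤ ‖z - b‖ / 2 := by
      calc (1 + 2 * C) * ‖z - b‖ ^ 2 = ((1 + 2 * C) * ‖z - b‖) * ‖z - b‖ := by ring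
        _ ≤ ((1 + 2 * C) * ρ) * ‖z - b‖ := by gcongr
        _ ≤ 1 / 2 * ‖z - b‖ := by gcongr
        _ = _ := by ring
    have h4 : ‖z - b‖ / 2 ≤ ‖(Complex.cos b - Complex.cos z) / Complex.sin b‖ := by linarith
    rw [norm_div, le_div_iff₀ hsb, norm_sub_rev (Complex.cos b)] at h4
    linarith
  refine subset_trans (Metric.ball_subset_ball ?_)
    (DiffContOnCl.ball_subset_image_closedBall (ε := ‖Complex.sin b‖ * ρ / 2)
      (Complex.differentiable_cos.diffContOnCl) hρ ?_ ?_)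
  · calc ‖Complex.sin b‖ * S ≤ ‖Complex.sin b‖ * (ρ / 4) := by gcongr
      _ = _ := by ring
  · intro z hz
    rw [mem_sphere_iff_norm] at hz
    have := hlow z hz.le
    rwa [hz] at this
  · refine Eventually.frequently (f := 𝓝[≠] b) ?_ |>.filter_mono nhdsWithin_le_nhds
    filter_upwards [self_mem_nhdsWithin, nhdsWithin_le_nhds (Metric.closedBall_mem_nhds b hρ)]
      with z hz hz'
    rw [mem_closedBall_iff_norm] at hz'
    have := hlow z hz'
    have h0 : 0 < ‖z - b‖ := norm_pos_iff.2 (sub_ne_zero.2 hz)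
    intro h
    rw [h, sub_self, norm_zero] at this
    have : 0 < ‖Complex.sin b‖ * ‖z - b‖ / 2 := by positivity
    linarith

lemma lintegral_indicator_inv_norm (b : ℂ) :
    ∫⁻ z : ℂ, (Set.Iio 1).indicator (fun x : ℝ => ENNReal.ofReal (1 / x)) ‖z - b‖ =
      ENNReal.ofReal (2 * Real.pi) := by
  rw [← lintegral_add_right_eq_self _ b]
  simp only [add_sub_cancel_right]
  rw [lintegral_norm (Measurable.indicator (by fun_prop) measurableSet_Iio)]
  have h : ∫⁻ x in Set.Ioi (0 : ℝ), ENNReal.ofReal x * (Set.Iio 1).indicator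
      (fun x : ℝ => ENNReal.ofReal (1 / x)) x = 1 := by
    calc _ = ∫⁻ x in Set.Ioi (0 : ℝ), (Set.Iio 1).indicator (fun _ : ℝ => (1 : ENNReal)) x := by
          refine setLIntegral_congr_fun measurableSet_Ioi fun x hx => ?_
          have hx' : 0 < x := hx
          by_cases h : x ∈ Set.Iio (1 : ℝ)
          · simp only [Set.indicator_of_mem h]
            rw [← ENNReal.ofReal_mul hx'.le, mul_one_div_cancel hx'.ne', ENNReal.ofReal_one]
          · simp [Set.indicator_of_notMem h]
      _ = _ := by
          rw [lintegral_indicator measurableSet_Iio, Measure.restrict_restrict measurableSet_Iio]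
          simp [Set.Iio_inter_Ioi]
  rw [h, one_mul]

lemma enorm_modelAt_of_mem {c b z : ℂ} {r R : ℝ} (hz : z ∈ annulus b r R) :
    ‖modelAt c b r R z‖ₑ = ENNReal.ofReal (‖c‖ / ‖z - b‖ ^ 2) := by
  rw [modelAt, Set.indicator_of_mem hz, ← ofReal_norm, norm_div, norm_pow]

/-- The estimates comparing `1 / h²` with `Q'(h)² / Q(h)²` when `Q(h) = h + O(h²)` and
`Q'(h) = 1 + O(h)`. -/
lemma norm_one_div_sq_sub_le {h Q Q' : ℂ} {K : ℝ} (hh : h ≠ 0) (hK : K * ‖h‖ ≤ 1 / 2)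
    (hQ : ‖Q - h‖ ≤ K * ‖h‖ ^ 2) (hQ' : ‖Q' - 1‖ ≤ K * ‖h‖) :
    ‖h‖ / 2 ≤ ‖Q‖ ∧ ‖Q‖ ≤ 3 / 2 * ‖h‖ ∧ ‖Q'‖ ^ 2 / ‖Q‖ ^ 2 ≤ 9 / ‖h‖ ^ 2 ∧
      ‖1 / h ^ 2 - Q' ^ 2 / Q ^ 2‖ ≤ 16 * K / ‖h‖ := by
  have h0 : 0 < ‖h‖ := norm_pos_iff.2 hh
  have hQ2 : ‖Q - h‖ ≤ ‖h‖ / 2 := by nlinarith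
  have h1 : ‖h‖ / 2 ≤ ‖Q‖ := by
    have := norm_sub_norm_le h Q
    rw [norm_sub_rev] at this
    linarith
  have h2 : ‖Q‖ ≤ 3 / 2 * ‖h‖ := by
    have := norm_sub_norm_le Q h
    linarith
  have h3 : ‖Q'‖ ≤ 3 / 2 := by
    have := norm_sub_norm_le Q' 1
    rw [norm_one] at this
    linarith
  have hQpos : 0 < ‖Q‖ := by linarith
  have hQ0 : Q ≠ 0 := norm_pos_iff.1 hQpos
  have h4 : ‖Q'‖ / ‖Q‖ ≤ 3 / ‖h‖ := by
    rw [div_le_div_iff₀ hQpos h0]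
    nlinarith [norm_nonneg Q']
  refine ⟨h1, h2, ?_, ?_⟩
  · rw [← div_pow]
    calc (‖Q'‖ / ‖Q‖) ^ 2 ≤ (3 / ‖h‖) ^ 2 := by gcongr
      _ = _ := by rw [div_pow]; norm_num
  -- Difference of squares; in `Q - h Q'` the leading terms cancel, so one power of `1/‖h‖` is
  -- gained.
  · have e1 : 1 / h ^ 2 - Q' ^ 2 / Q ^ 2 = ((Q - h) - h * (Q' - 1)) / (h * Q) * (1 / h + Q' / Q) := by
      field_simp
      ring
    have h5 : ‖((Q - h) - h * (Q' - 1)) / (h * Q)‖ ≤ 4 * K := by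
      rw [norm_div, norm_mul, div_le_iff₀ (by positivity)]
      have h6 := norm_sub_le (Q - h) (h * (Q' - 1))
      rw [norm_mul] at h6
      have hK0 : 0 ≤ K := by
        have := (norm_nonneg _).trans hQ'
        exact nonneg_of_mul_nonneg_left this h0
      calc _ ≤ K * ‖h‖ ^ 2 + ‖h‖ * (K * ‖h‖) := by
            refine h6.trans ?_
            gcongr
        _ = 4 * K * (‖h‖ * (‖h‖ / 2)) := by ring
        _ ≤ 4 * K * (‖h‖ * ‖Q‖) := by gcongr
    have h7 : ‖1 / h + Q' / Q‖ ≤ 4 / ‖h‖ := by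
      refine (norm_add_le _ _).trans ?_
      rw [norm_div, norm_div, norm_one]
      calc _ ≤ 1 / ‖h‖ + 3 / ‖h‖ := by gcongr
        _ = _ := by ring
    rw [e1, norm_mul]
    calc _ ≤ 4 * K * (4 / ‖h‖) := by
          gcongr
          exact (norm_nonneg _).trans h5
      _ = _ := by ring

/-- The model differential around a non-critical point of the cosine is mapped by the cosine to the
model differential around the image, up to an error of the size of the coefficient. -/
lemma exists_mass_pushforward_cos_modelAt_sub_le {δ : ℝ} (hδ : 0 < δ) :
    ∃ B ρ : ℝ, 0 < ρ ∧ ∀ (c b : ℂ) (r S : ℝ), (∀ k : ℤ, δ ≤ ‖b - (k : ℂ) * (Real.pi : ℂ)‖) →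
      0 < r → r < S → S ≤ ρ →
      mass (pushforward Complex.cos (modelAt c b r S) -
        modelAt c (Complex.cos b) (‖Complex.sin b‖ * r) (‖Complex.sin b‖ * S)) Set.univ ≤
          ENNReal.ofReal (‖c‖ * B) := by
  set s := 2 / Real.pi * δ with hs
  have hs0 : 0 < s := by positivity
  set C := 1 + 1 / s with hCdef
  have hC0 : 0 < C := by positivity
  set K := 1 + 2 * C with hK
  have hK0 : 0 < K := by positivity
  set ρ := min (δ / 2) (min 1 (1 / (2 * K))) with hρdef
  have hρ : 0 < ρ := by positivity
  have hρδ : ρ < δ := (min_le_left _ _).trans_lt (by linarith)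
  have hρ1 : ρ ≤ 1 := (min_le_right _ _).trans (min_le_left _ _)
  have hρK : K * ρ ≤ 1 / 2 := by
    have : ρ ≤ 1 / (2 * K) := (min_le_right _ _).trans (min_le_right _ _)
    calc K * ρ ≤ K * (1 / (2 * K)) := by gcongr
      _ = 1 / 2 := by field_simp
  -- The first term integrates the pointwise error `16 K / ‖z - b‖` over the unit disk. The other
  -- two are collars of radius ratio `9` around the circles of radii `r` and `S`.
  refine ⟨16 * K * (2 * Real.pi) + 9 * (2 * Real.pi * Real.log 9) +
    9 * (2 * Real.pi * Real.log 9), ρ / 4, by positivity, fun c b r S hb hr hrS hS => ?_⟩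
  have hsb := le_norm_sin_of_forall_le_norm_sub hδ.le hb
  have hsb0 : 0 < ‖Complex.sin b‖ := hs0.trans_le hsb
  have hsin : Complex.sin b ≠ 0 := norm_pos_iff.1 hsb0
  have hC := norm_cos_div_sin_le hs0 hsb
  have hS0 : 0 < S := hr.trans hrS
  set D := Metric.closedBall b ρ with hD
  have hquot : ∀ z ∈ D, ‖z - b‖ ≤ ρ ∧
      ‖(Complex.cos b - Complex.cos z) / Complex.sin b - (z - b)‖ ≤ K * ‖z - b‖ ^ 2 ∧
      ‖Complex.sin z / Complex.sin b - 1‖ ≤ K * ‖z - b‖ := by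
    intro z hz
    have hz' : ‖z - b‖ ≤ ρ := mem_closedBall_iff_norm.1 hz
    have := norm_normalized_cos_sub_le hsin hC (hz'.trans hρ1)
    rw [add_sub_cancel] at this
    exact ⟨hz', this⟩
  have hsinD : ∀ z ∈ D, Complex.sin z ≠ 0 := by
    intro z hz h0
    obtain ⟨h1, -, h2⟩ := hquot z hz
    rw [h0, zero_div, zero_sub, norm_neg, norm_one] at h2
    have : K * ‖z - b‖ ≤ K * ρ := by gcongr
    linarith
  set m' := modelAt c (Complex.cos b) (‖Complex.sin b‖ * r) (‖Complex.sin b‖ * S) with hm'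
  have hsupp : Function.support m' ⊆ Complex.cos '' D := by
    refine subset_trans ?_ (ball_subset_cos_image hsin hC hρ hρ1 hρK hS)
    intro w hw
    rw [mem_ball_iff_norm]
    by_contra hc
    exact hw (Set.indicator_of_notMem (fun h => hc h.2) _)
  -- The pull-back of the target model to the disk; it remains to compare `m` and `p` upstairs.
  set p := D.indicator fun z => m' (Complex.cos z) * Complex.sin z ^ 2 with hp
  have hpush : pushforward Complex.cos p = m' :=
    pushforward_cos_indicator_mul (injOn_cos_closedBall hb hρδ hρ1) hsinD hsupp
  have hpm : Measurable p :=
    (((measurable_modelAt _ _ _ _).comp Complex.continuous_cos.measurable).mul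
      (Complex.continuous_sin.measurable.pow_const 2)).indicator measurableSet_closedBall
  set m := modelAt c b r S with hm
  have hmm : Measurable m := measurable_modelAt _ _ _ _
  have hmfin : mass m Set.univ < ⊤ := by
    rw [hm, mass_modelAt c b hr hrS.le]; exact ENNReal.ofReal_lt_top
  set I := fun z => (Set.Iio 1).indicator (fun x : ℝ => ENNReal.ofReal (1 / x)) ‖z - b‖ with hI
  have hIm : Measurable I := by
    refine (Measurable.indicator (by fun_prop) measurableSet_Iio).comp ?_
    fun_prop
  have hbound : ∀ z, ‖(m - p) z‖ₑ ≤ ENNReal.ofReal (‖c‖ * (16 * K)) * I z +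
      9 * ‖modelAt c b (r / 3) (3 * r) z‖ₑ + 9 * ‖modelAt c b (S / 3) (3 * S) z‖ₑ := by
    intro z
    by_cases hzb : z = b
    · have h1 : m z = 0 := Set.indicator_of_notMem (fun h => by
        have := h.1; rw [hzb, sub_self, norm_zero] at this; linarith) _
      have h2 : p z = 0 := by
        have : m' (Complex.cos z) = 0 := Set.indicator_of_notMem (fun h => by
          have := h.1
          rw [hzb, sub_self, norm_zero] at this
          have : 0 < ‖Complex.sin b‖ * r := by positivity
          linarith) _
        simp [hp, Set.indicator, this]
      simp [h1, h2]
    by_cases hzD : z ∈ D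
    swap
    · have h1 : m z = 0 := Set.indicator_of_notMem (fun h => hzD (by
        rw [hD, mem_closedBall_iff_norm]; have := h.2; linarith)) _
      have h2 : p z = 0 := Set.indicator_of_notMem hzD _
      simp [h1, h2]
    have hh0 : 0 < ‖z - b‖ := norm_pos_iff.2 (sub_ne_zero.2 hzb)
    obtain ⟨hz, hQ, hQ'⟩ := hquot z hzD
    have hKz : K * ‖z - b‖ ≤ 1 / 2 := le_trans (by gcongr) hρK
    obtain ⟨e1, e2, e3, e4⟩ := norm_one_div_sq_sub_le (sub_ne_zero.2 hzb) hKz hQ hQ'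
    set Q := (Complex.cos b - Complex.cos z) / Complex.sin b with hQdef
    set Q' := Complex.sin z / Complex.sin b with hQ'def
    have hpz : p z = if ‖Q‖ ∈ Set.Ioo r S then c * (Q' ^ 2 / Q ^ 2) else 0 := by
      have hmem : Complex.cos z ∈ annulus (Complex.cos b) (‖Complex.sin b‖ * r)
          (‖Complex.sin b‖ * S) ↔ ‖Q‖ ∈ Set.Ioo r S := by
        rw [hQdef, norm_div, norm_sub_rev, Set.mem_Ioo, lt_div_iff₀ hsb0, div_lt_iff₀ hsb0,
          mul_comm r, mul_comm S]
        rfl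
      rw [hp, Set.indicator_of_mem hzD]
      split_ifs with h
      · rw [hm', modelAt, Set.indicator_of_mem (hmem.2 h), hQdef, hQ'def, div_pow, div_pow,
          div_div_div_cancel_right₀ (pow_ne_zero 2 hsin)]
        rw [← neg_sub (Complex.cos z), neg_sq]
        ring
      · rw [hm', modelAt, Set.indicator_of_notMem fun h' => h (hmem.1 h'), zero_mul]
    have hmz : m z = if ‖z - b‖ ∈ Set.Ioo r S then c * (1 / (z - b) ^ 2) else 0 := by
      split_ifs with h
      · rw [hm, modelAt, Set.indicator_of_mem (show z ∈ annulus b r S from h), mul_one_div]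
      · rw [hm, modelAt, Set.indicator_of_notMem (show z ∉ annulus b r S from h)]
    have hone : ‖m z - p z‖ₑ ≤ ENNReal.ofReal (9 * (‖c‖ / ‖z - b‖ ^ 2)) →
        (z ∈ annulus b (r / 3) (3 * r) ∨ z ∈ annulus b (S / 3) (3 * S)) →
        ‖(m - p) z‖ₑ ≤ ENNReal.ofReal (‖c‖ * (16 * K)) * I z +
          9 * ‖modelAt c b (r / 3) (3 * r) z‖ₑ + 9 * ‖modelAt c b (S / 3) (3 * S) z‖ₑ := by
      intro h1 h2
      rw [ENNReal.ofReal_mul (by norm_num), show ENNReal.ofReal 9 = 9 by norm_num] at h1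
      refine h1.trans ?_
      rcases h2 with h2 | h2
      · rw [enorm_modelAt_of_mem h2]
        exact le_add_right le_add_self
      · rw [enorm_modelAt_of_mem h2]
        exact le_add_self
    have hval1 : ‖c * (1 / (z - b) ^ 2)‖ ≤ 9 * (‖c‖ / ‖z - b‖ ^ 2) := by
      rw [norm_mul, norm_div, norm_one, norm_pow, mul_one_div]
      have : 0 ≤ ‖c‖ / ‖z - b‖ ^ 2 := by positivity
      linarith
    have hval2 : ‖c * (Q' ^ 2 / Q ^ 2)‖ ≤ 9 * (‖c‖ / ‖z - b‖ ^ 2) := by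
      rw [norm_mul, norm_div, norm_pow, norm_pow]
      calc ‖c‖ * (‖Q'‖ ^ 2 / ‖Q‖ ^ 2) ≤ ‖c‖ * (9 / ‖z - b‖ ^ 2) := by gcongr
        _ = _ := by ring
    -- If only one of the two models is nonzero at `z`, then `‖z - b‖ / 2 ≤ ‖Q‖ ≤ 3/2 ‖z - b‖` puts
    -- `z` in a collar, where the crude bound `9 ‖c‖ / ‖z - b‖²` suffices.
    by_cases h1 : ‖z - b‖ ∈ Set.Ioo r S <;> by_cases h2 : ‖Q‖ ∈ Set.Ioo r S
    · have hI1 : I z = ENNReal.ofReal (1 / ‖z - b‖) := by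
        refine Set.indicator_of_mem (Set.mem_Iio.2 ?_) _
        have := h1.2
        linarith
      rw [add_assoc]
      refine le_add_right ?_
      rw [Pi.sub_apply, hmz, hpz, if_pos h1, if_pos h2, hI1, ← ENNReal.ofReal_mul (by positivity),
        ← ofReal_norm, ← mul_sub, norm_mul]
      refine ENNReal.ofReal_le_ofReal ?_
      calc _ ≤ ‖c‖ * (16 * K / ‖z - b‖) := by gcongr
        _ = _ := by ring
    · refine hone ?_ ?_
      · rw [hmz, hpz, if_pos h1, if_neg h2, sub_zero, ← ofReal_norm]
        exact ENNReal.ofReal_le_ofReal hval1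
      · rw [Set.mem_Ioo, not_and_or, not_lt, not_lt] at h2
        rcases h2 with h2 | h2
        · exact Or.inl ⟨by linarith [h1.1], by linarith⟩
        · exact Or.inr ⟨by linarith, by linarith [h1.2]⟩
    · refine hone ?_ ?_
      · rw [hmz, hpz, if_neg h1, if_pos h2, zero_sub, enorm_neg, ← ofReal_norm]
        exact ENNReal.ofReal_le_ofReal hval2
      · rw [Set.mem_Ioo, not_and_or, not_lt, not_lt] at h1
        have h3 := h2.1
        have h4 := h2.2
        rcases h1 with h1 | h1
        · exact Or.inl ⟨by linarith, by linarith⟩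
        · exact Or.inr ⟨by linarith, by linarith⟩
    · rw [Pi.sub_apply, hmz, hpz, if_neg h1, if_neg h2, sub_zero, enorm_zero]
      exact zero_le
  have hmain : mass (m - p) Set.univ ≤ ENNReal.ofReal (‖c‖ * (16 * K * (2 * Real.pi) +
      9 * (2 * Real.pi * Real.log 9) + 9 * (2 * Real.pi * Real.log 9))) := by
    have hmodel : ∀ x : ℝ, 0 < x → ∫⁻ z, 9 * ‖modelAt c b (x / 3) (3 * x) z‖ₑ =
        ENNReal.ofReal (‖c‖ * (9 * (2 * Real.pi * Real.log 9))) := by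
      intro x hx
      rw [lintegral_const_mul' _ _ (by simp)]
      have := mass_modelAt c b (r := x / 3) (R := 3 * x) (by positivity) (by linarith)
      rw [mass, Measure.restrict_univ] at this
      rw [this, show 3 * x / (x / 3) = 9 by field_simp; norm_num, ← show ENNReal.ofReal 9 = 9 by
        norm_num, ← ENNReal.ofReal_mul (by norm_num)]
      congr 1
      ring
    rw [mass, Measure.restrict_univ]
    refine (lintegral_mono hbound).trans_eq ?_
    rw [lintegral_add_right _ ((measurable_modelAt _ _ _ _).enorm.const_mul 9),
      lintegral_add_right _ ((measurable_modelAt _ _ _ _).enorm.const_mul 9),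
      lintegral_const_mul _ hIm, hmodel r hr, hmodel S hS0, lintegral_indicator_inv_norm,
      ← ENNReal.ofReal_mul (by positivity)]
    have hl : 0 ≤ Real.log 9 := Real.log_nonneg (by norm_num)
    rw [← ENNReal.ofReal_add (by positivity) (by positivity),
      ← ENNReal.ofReal_add (by positivity) (by positivity)]
    congr 1
    ring
  have hpfin : mass p Set.univ < ⊤ := by
    refine (mass_le_mass_sub_add hmm.aestronglyMeasurable _).trans_lt ?_
    rw [mass_sub_comm p m]
    exact ENNReal.add_lt_top.2 ⟨hmfin, hmain.trans_lt ENNReal.ofReal_lt_top⟩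
  refine le_trans ?_ hmain
  rw [← hpush]
  exact mass_pushforward_cos_sub_le hmm.aestronglyMeasurable hmfin hpm.aestronglyMeasurable hpfin

/-! ### Asymptotics of annular limit models -/

lemma tendsto_of_le_add_of_le_add {u v e : ℕ → ENNReal} {a : ENNReal} (ha : a ≠ ⊤)
    (he : Tendsto e atTop (𝓝 0)) (huv : ∀ n, u n ≤ v n + e n) (hvu : ∀ n, v n ≤ u n + e n)
    (hv : Tendsto v atTop (𝓝 a)) : Tendsto u atTop (𝓝 a) := by
  have h1 : Tendsto (fun n => v n - e n) atTop (𝓝 a) := by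
    simpa using ENNReal.Tendsto.sub hv he (Or.inl ha)
  have h2 : Tendsto (fun n => v n + e n) atTop (𝓝 a) := by simpa using hv.add he
  exact tendsto_of_tendsto_of_tendsto_of_le_of_le h1 h2 (fun n => tsub_le_iff_right.2 (hvu n)) huv

lemma tendsto_ofReal_nnreal_iff {y : ℕ → ℝ} (hy : ∀ n, 0 ≤ y n) {β : NNReal} :
    Tendsto (fun n => ENNReal.ofReal (y n)) atTop (𝓝 (β : ENNReal)) ↔
      Tendsto y atTop (𝓝 (β : ℝ)) := by
  constructor
  · intro h
    have := (ENNReal.tendsto_toReal ENNReal.coe_ne_top).comp h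
    simpa [Function.comp_def, ENNReal.toReal_ofReal (hy _)] using this
  · intro h
    have := ENNReal.tendsto_ofReal h
    rwa [ENNReal.ofReal_coe_nnreal] at this

/-- Turns concentration of mass into a statement about numbers: one direction validates the
constructed radii, the other exploits arbitrary given ones. -/
lemma modelAt_annulus_comparison {q : ℕ → ℂ → ℂ} (hq : ∀ n, AEStronglyMeasurable (q n) volume)
    {b c : ℕ → ℂ} {r R S : ℕ → ℝ} (hr : ∀ n, 0 < r n) (hS : ∀ n, r n < S n)
    (hSR : ∀ n, S n ≤ R n)
    (herr : Tendsto (fun n => mass (q n - modelAt (c n) (b n) (r n) (R n)) Set.univ) atTop (𝓝 0))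
    {β : NNReal} :
    Tendsto (fun n => mass (q n) (annulus (b n) (r n) (S n))) atTop (𝓝 (β : ENNReal)) ↔
      Tendsto (fun n => ‖c n‖ * (2 * Real.pi * Real.log (S n / r n))) atTop (𝓝 (β : ℝ)) := by
  have hnn : ∀ n, 0 ≤ ‖c n‖ * (2 * Real.pi * Real.log (S n / r n)) := fun n => by
    have := Real.log_nonneg ((one_le_div (hr n)).2 (hS n).le)
    positivity
  rw [← tendsto_ofReal_nnreal_iff hnn]
  have heq : ∀ n, mass (modelAt (c n) (b n) (r n) (R n)) (annulus (b n) (r n) (S n)) =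
      ENNReal.ofReal (‖c n‖ * (2 * Real.pi * Real.log (S n / r n))) := fun n =>
    mass_modelAt_annulus _ _ (hr n) (hS n).le le_rfl (hSR n)
  simp_rw [← heq]
  have h1 : ∀ n, mass (q n) (annulus (b n) (r n) (S n)) ≤
      mass (modelAt (c n) (b n) (r n) (R n)) (annulus (b n) (r n) (S n)) +
        mass (q n - modelAt (c n) (b n) (r n) (R n)) Set.univ := fun n =>
    (mass_le_mass_sub_add (measurable_modelAt _ _ _ _).aestronglyMeasurable _).trans
      (by gcongr; exact mass_mono (Set.subset_univ _))
  have h2 : ∀ n, mass (modelAt (c n) (b n) (r n) (R n)) (annulus (b n) (r n) (S n)) ≤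
      mass (q n) (annulus (b n) (r n) (S n)) +
        mass (q n - modelAt (c n) (b n) (r n) (R n)) Set.univ := fun n => by
    refine (mass_le_mass_sub_add (hq n) _).trans ?_
    rw [mass_sub_comm]
    gcongr
    exact mass_mono (Set.subset_univ _)
  exact ⟨tendsto_of_le_add_of_le_add ENNReal.coe_ne_top herr h2 h1,
    tendsto_of_le_add_of_le_add ENNReal.coe_ne_top herr h1 h2⟩

lemma HasAnnularLimitModel.exists_coefficients {q : ℕ → ℂ → ℂ} {b : ℕ → ℂ} {r R : ℕ → ℝ}
    (h : HasAnnularLimitModel q b r R) : ∃ (β : NNReal) (c : ℕ → ℂ), β ≠ 0 ∧ (∀ n, c n ≠ 0) ∧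
      Tendsto (fun n => mass (q n) Set.univ) atTop (𝓝 (β : ENNReal)) ∧
      Tendsto (fun n => mass (q n - modelAt (c n) (b n) (r n) (R n)) Set.univ) atTop (𝓝 0) ∧
      Tendsto (fun n => mass (modelAt (c n) (b n) (r n) (R n)) Set.univ) atTop
        (𝓝 (β : ENNReal)) ∧
      Tendsto (fun n => ‖c n‖ * (2 * Real.pi * Real.log (R n / r n))) atTop (𝓝 (β : ℝ)) ∧
      Tendsto (fun n => ‖c n‖) atTop (𝓝 0) := by
  obtain ⟨hq, -, ⟨β, hβ, hmass⟩, hr, c, hc, hratio, herr⟩ := h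
  simp_rw [mass_pullback_sub] at herr
  have hm : Tendsto (fun n => mass (modelAt (c n) (b n) (r n) (R n)) Set.univ) atTop
      (𝓝 (β : ENNReal)) := by
    refine tendsto_of_le_add_of_le_add ENNReal.coe_ne_top herr (fun n => ?_) (fun n => ?_) hmass
    · rw [mass_sub_comm]
      exact mass_le_mass_sub_add (hq n) _
    · exact mass_le_mass_sub_add (measurable_modelAt _ _ _ _).aestronglyMeasurable _
  have hlog : Tendsto (fun n => Real.log (R n / r n)) atTop atTop :=
    Real.tendsto_log_atTop.comp hratio
  have hlim : Tendsto (fun n => ‖c n‖ * (2 * Real.pi * Real.log (R n / r n))) atTop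
      (𝓝 (β : ℝ)) := by
    rw [← tendsto_ofReal_nnreal_iff]
    · refine hm.congr fun n => ?_
      exact mass_modelAt _ _ (hr n).1 (hr n).2.le
    · intro n
      have := Real.log_nonneg ((one_le_div (hr n).1).2 (hr n).2.le)
      positivity
  refine ⟨β, c, hβ, hc, hmass, herr, hm, hlim, ?_⟩
  -- The product has a finite limit while its logarithmic factor diverges, so the coefficients tend
  -- to `0`.
  have h2 := hlim.div_atTop (hlog.const_mul_atTop Real.two_pi_pos)
  refine h2.congr' ?_
  filter_upwards [hlog.eventually_gt_atTop 0] with n hn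
  have := Real.pi_pos
  field_simp

/-- If the push-forwards of a sequence with an annular limit model asymptotically keep the mass,
then the part of the annuli outside a disk of bounded radius carries no mass in the limit. -/
lemma tendsto_max_mul_log_zero {q : ℕ → ℂ → ℂ} (hq : ∀ n, AEStronglyMeasurable (q n) volume)
    {b c : ℕ → ℂ} {r R : ℕ → ℝ} (hr : ∀ n, 0 < r n ∧ r n < R n) {β : NNReal}
    (hfin : ∀ n, mass (q n) Set.univ < ⊤)
    (hpush : Tendsto (fun n => mass (pushforward Complex.cos (q n)) Set.univ) atTop
      (𝓝 (β : ENNReal)))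
    (herr : Tendsto (fun n => mass (q n - modelAt (c n) (b n) (r n) (R n)) Set.univ) atTop (𝓝 0))
    (hm : Tendsto (fun n => mass (modelAt (c n) (b n) (r n) (R n)) Set.univ) atTop
      (𝓝 (β : ENNReal)))
    (hc : Tendsto (fun n => ‖c n‖) atTop (𝓝 0)) :
    Tendsto (fun n => max (‖c n‖ * Real.log (R n / (r n + Real.pi))) 0) atTop (𝓝 0) := by
  obtain ⟨η, hη, hloss⟩ := exists_mass_pushforward_cos_modelAt_loss
  have hmm : ∀ n, AEStronglyMeasurable (modelAt (c n) (b n) (r n) (R n)) volume := fun n =>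
    (measurable_modelAt _ _ _ _).aestronglyMeasurable
  have hmfin : ∀ n, mass (modelAt (c n) (b n) (r n) (R n)) Set.univ < ⊤ := fun n => by
    rw [mass_modelAt _ _ (hr n).1 (hr n).2.le]; exact ENNReal.ofReal_lt_top
  have hpm : Tendsto (fun n => mass (pushforward Complex.cos
      (modelAt (c n) (b n) (r n) (R n))) Set.univ) atTop (𝓝 (β : ENNReal)) := by
    refine tendsto_of_le_add_of_le_add ENNReal.coe_ne_top herr (fun n => ?_) (fun n => ?_) hpush
    · refine (mass_le_mass_sub_add
        (aestronglyMeasurable_pushforward_cos (hq n) (hfin n)) _).trans ?_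
      gcongr
      rw [mass_sub_comm (q n)]
      exact mass_pushforward_cos_sub_le (hmm n) (hmfin n) (hq n) (hfin n)
    · refine (mass_le_mass_sub_add
        (aestronglyMeasurable_pushforward_cos (hmm n) (hmfin n)) _).trans ?_
      gcongr
      exact mass_pushforward_cos_sub_le (hq n) (hfin n) (hmm n) (hmfin n)
  have hdiff := ENNReal.Tendsto.sub hm hpm (Or.inl ENNReal.coe_ne_top)
  rw [tsub_self] at hdiff
  have hy : Tendsto (fun n => ENNReal.ofReal (‖c n‖ *
      (η * (Real.log (R n / (r n + Real.pi)) / Real.log 2 - 1)))) atTop (𝓝 0) := by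
    refine tendsto_of_tendsto_of_tendsto_of_le_of_le tendsto_const_nhds hdiff
      (fun n => zero_le) fun n => ?_
    refine ENNReal.le_sub_of_add_le_right ?_ (hloss _ _ _ _ (hr n).1 (hr n).2)
    exact ne_top_of_le_ne_top (hmfin n).ne (mass_pushforward_cos_le (hmm n))
  have hy' := (ENNReal.tendsto_toReal ENNReal.zero_ne_top).comp hy
  simp only [Function.comp_def, ENNReal.toReal_ofReal', ENNReal.toReal_zero] at hy'
  have hl2 : 0 < Real.log 2 := Real.log_pos one_lt_two
  -- Dropping the `- 1` from the count of dyadic annuli costs `‖c n‖ log 2`, which tends to `0`.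
  have hup := (hy'.const_mul (Real.log 2 / η)).add (hc.mul_const (Real.log 2))
  rw [mul_zero, zero_mul, add_zero] at hup
  refine squeeze_zero (fun n => le_max_right _ _) (fun n => ?_) hup
  refine max_le ?_ (by positivity)
  calc ‖c n‖ * Real.log (R n / (r n + Real.pi)) =
      Real.log 2 / η * (‖c n‖ * (η * (Real.log (R n / (r n + Real.pi)) / Real.log 2 - 1))) +
        ‖c n‖ * Real.log 2 := by field_simp; ring
    _ ≤ _ := by gcongr; exact le_max_left _ _

/-- Shrinking of the outer radii: a purely numerical statement. -/
lemma exists_shrunk_radii {x r R : ℕ → ℝ} {γ : ℝ} (hγ : 0 < γ) (hx : ∀ n, 0 < x n)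
    (hx0 : Tendsto x atTop (𝓝 0)) (hr : ∀ n, 0 < r n ∧ r n < R n)
    (hlim : Tendsto (fun n => x n * Real.log (R n / r n)) atTop (𝓝 γ))
    (hout : Tendsto (fun n => max (x n * Real.log (R n / (r n + Real.pi))) 0) atTop (𝓝 0)) :
    ∃ S : ℕ → ℝ, (∀ n, S n ∈ Set.Ioo (r n) (R n)) ∧ Tendsto S atTop (𝓝 0) ∧
      Tendsto (fun n => x n * Real.log (S n / r n)) atTop (𝓝 γ) := by
  set l := fun n => Real.log (R n / r n) with hl
  set t := fun n => Real.log ((r n + Real.pi) / r n) with ht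
  -- The logarithmic width of the annulus from `r n` to the smaller of `r n + π` and `R n`, which
  -- carries all the mass in the limit.
  set u := fun n => min (t n) (l n) with hu
  have hpi := Real.pi_pos
  have hl0 : ∀ n, 0 < l n := fun n => Real.log_pos ((one_lt_div (hr n).1).2 (hr n).2)
  have ht0 : ∀ n, 0 < t n := fun n =>
    Real.log_pos ((one_lt_div (hr n).1).2 (by linarith))
  have hu0 : ∀ n, 0 < u n := fun n => lt_min (ht0 n) (hl0 n)
  have hlt : ∀ n, Real.log (R n / (r n + Real.pi)) = l n - t n := fun n => by
    have h1 := (hr n).1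
    have h2 := h1.trans (hr n).2
    simp only [hl, ht]
    rw [Real.log_div h2.ne' (by positivity), Real.log_div h2.ne' h1.ne',
      Real.log_div (by positivity) h1.ne']
    ring
  have hxu : Tendsto (fun n => x n * u n) atTop (𝓝 γ) := by
    have := hlim.sub hout
    rw [sub_zero] at this
    refine this.congr fun n => ?_
    rw [hlt]
    simp only [hu, hl]
    rcases le_total (t n) (Real.log (R n / r n)) with h | h
    · rw [min_eq_left h, max_eq_left (mul_nonneg (hx n).le (sub_nonneg.2 h))]
      ring
    · rw [min_eq_right h, max_eq_right (mul_nonpos_of_nonneg_of_nonpos (hx n).le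
        (sub_nonpos.2 h)), sub_zero]
  have hxinv : Tendsto (fun n => (x n)⁻¹) atTop atTop :=
    tendsto_inv_nhdsGT_zero.comp
      (tendsto_nhdsWithin_iff.2 ⟨hx0, Eventually.of_forall hx⟩)
  have huTop : Tendsto u atTop atTop := by
    refine (hxu.pos_mul_atTop hγ hxinv).congr fun n => ?_
    have := (hx n).ne'
    field_simp
  have htTop : Tendsto t atTop atTop := tendsto_atTop_mono (fun n => min_le_left _ _) huTop
  have hexp : ∀ n, r n * Real.exp (t n) = r n + Real.pi := fun n => by
    have h1 := (hr n).1
    simp only [ht]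
    rw [Real.exp_log (by positivity)]
    field_simp
  -- The ratio `(r + π) / r` tends to infinity.
  have hr0 : Tendsto r atTop (𝓝 0) := by
    have h1 : Tendsto (fun n => Real.exp (t n) - 1) atTop atTop :=
      tendsto_atTop_add_const_right _ _ (Real.tendsto_exp_atTop.comp htTop)
    refine ((tendsto_const_nhds (x := Real.pi)).div_atTop h1).congr fun n => ?_
    have h2 : 0 < Real.exp (t n) - 1 := sub_pos.2 (Real.one_lt_exp_iff.2 (ht0 n))
    rw [div_eq_iff h2.ne', mul_sub, hexp]
    ring
  -- The logarithmic width is reduced by `u k`, of order `√u`: negligible relative to `u`, yet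
  -- divergent, so the outer radius, at most `(r + π) exp (-u k)`, tends to `0`.
  set k := fun n => 1 / (1 + √(u n)) with hk
  have hsq : Tendsto (fun n => √(u n)) atTop atTop := Real.tendsto_sqrt_atTop.comp huTop
  have hk0 : Tendsto k atTop (𝓝 0) :=
    tendsto_const_nhds.div_atTop (tendsto_atTop_add_const_left _ _ hsq)
  have hkpos : ∀ n, 0 < k n := fun n => by simp only [hk]; positivity
  have hk1 : ∀ n, k n < 1 := fun n => by
    have : 0 < √(u n) := Real.sqrt_pos.2 (hu0 n)
    simp only [hk]
    rw [div_lt_one (by positivity)]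
    linarith
  have hw : Tendsto (fun n => u n * k n) atTop atTop := by
    refine tendsto_atTop_mono (fun n => ?_) (tendsto_atTop_add_const_right _ (-1) hsq)
    simp only [hk]
    rw [mul_one_div, le_div_iff₀ (by positivity)]
    nlinarith [Real.sq_sqrt (hu0 n).le]
  refine ⟨fun n => r n * Real.exp (u n * (1 - k n)), fun n => ⟨?_, ?_⟩, ?_, ?_⟩
  · exact lt_mul_of_one_lt_right (hr n).1
      (Real.one_lt_exp_iff.2 (mul_pos (hu0 n) (sub_pos.2 (hk1 n))))
  · have h1 := (hr n).1
    have h2 : u n * (1 - k n) < l n := by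
      have h3 : u n ≤ l n := min_le_right _ _
      nlinarith [mul_pos (hu0 n) (hkpos n)]
    calc r n * Real.exp (u n * (1 - k n)) < r n * Real.exp (l n) := by gcongr
      _ = R n := by
        simp only [hl]
        rw [Real.exp_log (div_pos (h1.trans (hr n).2) h1)]
        field_simp
  · have hlim0 : Tendsto (fun n => (r n + Real.pi) * Real.exp (-(u n * k n))) atTop (𝓝 0) := by
      have := (hr0.add_const Real.pi).mul
        (Real.tendsto_exp_atBot.comp (tendsto_neg_atTop_atBot.comp hw))
      simpa using this
    refine squeeze_zero (fun n => mul_nonneg (hr n).1.le (Real.exp_pos _).le) (fun n => ?_) hlim0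
    have h1 := (hr n).1
    rw [← hexp, mul_assoc, ← Real.exp_add]
    have h2 : u n ≤ t n := min_le_left _ _
    gcongr
    linarith
  · have := hxu.mul ((tendsto_const_nhds (x := (1 : ℝ))).sub hk0)
    rw [sub_zero, mul_one] at this
    refine this.congr fun n => ?_
    rw [mul_div_cancel_left₀ _ (hr n).1.ne', Real.log_exp, mul_assoc]

lemma CosEfficient.tendsto_mass_pushforward {q : ℕ → ℂ → ℂ} (h : CosEfficient q)
    (hfin : ∀ n, mass (q n) Set.univ < ⊤) {β : NNReal}
    (hmass : Tendsto (fun n => mass (q n) Set.univ) atTop (𝓝 (β : ENNReal))) :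
    Tendsto (fun n => mass (pushforward Complex.cos (q n)) Set.univ) atTop
      (𝓝 (β : ENNReal)) := by
  have := ENNReal.Tendsto.mul h.2.2 (Or.inl one_ne_zero) hmass (Or.inr ENNReal.one_ne_top)
  rw [one_mul] at this
  exact this.congr fun n => ENNReal.div_mul_cancel (h.2.1 n) (hfin n).ne

end QuadDiff

theorem proposition5p2 (q : ℕ → ℂ → ℂ) (b : ℕ → ℂ) (r R : ℕ → ℝ)
    (hmodel : QuadDiff.HasAnnularLimitModel q b r R)
    (heff : QuadDiff.CosEfficient q) :
    (∃ S : ℕ → ℝ, QuadDiff.ConcentratesOn q b r R S) ∧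
    (∀ S : ℕ → ℝ, QuadDiff.ConcentratesOn q b r R S →
      QuadDiff.StaysAwayFromCriticalPoints b →
      ∃ N : ℕ, QuadDiff.HasAnnularLimitModel
        (fun n => QuadDiff.pushforward Complex.cos (q (n + N)))
        (fun n => Complex.cos (b (n + N)))
        (fun n => ‖Complex.sin (b (n + N))‖ * r (n + N))
        (fun n => ‖Complex.sin (b (n + N))‖ * S (n + N))) := by
  open QuadDiff in
  have hq := hmodel.1
  have hfin : ∀ n, mass (q n) Set.univ < ⊤ := fun n => (hmodel.2.1 n).2
  have hr := hmodel.2.2.2.1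
  obtain ⟨β, c, hβ, hc, hmass, herr, hm, hlim, hc0⟩ := hmodel.exists_coefficients
  have hpush := heff.tendsto_mass_pushforward hfin hmass
  have hout := tendsto_max_mul_log_zero hq hr hfin hpush herr hm hc0
  have hβ0 : (β : ENNReal) ≠ 0 := by simpa using hβ
  have hβpos : 0 < (β : ℝ) := by exact_mod_cast pos_iff_ne_zero.2 hβ
  have hqR : Tendsto (fun n => mass (q n) (annulus (b n) (r n) (R n))) atTop
      (𝓝 (β : ENNReal)) :=
    (modelAt_annulus_comparison hq (fun n => (hr n).1) (fun n => (hr n).2) (fun n => le_rfl)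
      herr).2 hlim
  constructor
  · have hlim' : Tendsto (fun n => ‖c n‖ * Real.log (R n / r n)) atTop
        (𝓝 (β / (2 * Real.pi))) := by
      refine (hlim.div_const (2 * Real.pi)).congr fun n => ?_
      have := Real.pi_pos
      field_simp
    obtain ⟨S, hS, hS0, hSlim⟩ := exists_shrunk_radii (div_pos hβpos Real.two_pi_pos)
      (fun n => norm_pos_iff.2 (hc n)) hc0 hr hlim' hout
    refine ⟨S, hS, hS0, ?_⟩
    have hqS : Tendsto (fun n => mass (q n) (annulus (b n) (r n) (S n))) atTop
        (𝓝 (β : ENNReal)) := by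
      refine (modelAt_annulus_comparison hq (fun n => (hr n).1) (fun n => (hS n).1)
        (fun n => (hS n).2.le) herr).2 ?_
      have := hSlim.mul_const (2 * Real.pi)
      rw [div_mul_cancel₀ _ Real.two_pi_pos.ne'] at this
      exact this.congr fun n => by ring
    have := ENNReal.Tendsto.div hqS (Or.inl hβ0) hqR (Or.inl ENNReal.coe_ne_top)
    rwa [ENNReal.div_self hβ0 ENNReal.coe_ne_top] at this
  · rintro S ⟨hS, hS0, hconc⟩ ⟨δ, hδ, hb⟩
    have hqS : Tendsto (fun n => mass (q n) (annulus (b n) (r n) (S n))) atTop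
        (𝓝 (β : ENNReal)) := by
      have := ENNReal.Tendsto.mul hconc (Or.inl one_ne_zero) hqR (Or.inr ENNReal.one_ne_top)
      rw [one_mul] at this
      refine this.congr' ?_
      filter_upwards [hqR.eventually_ne hβ0] with n hn
      exact ENNReal.div_mul_cancel hn ((mass_mono (Set.subset_univ _)).trans_lt (hfin n)).ne
    have hSlim := (modelAt_annulus_comparison hq (fun n => (hr n).1) (fun n => (hS n).1)
      (fun n => (hS n).2.le) herr).1 hqS
    have hSr : Tendsto (fun n => S n / r n) atTop atTop := by
      have hcinv : Tendsto (fun n => ‖c n‖⁻¹) atTop atTop :=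
        tendsto_inv_nhdsGT_zero.comp
          (tendsto_nhdsWithin_iff.2 ⟨hc0, Eventually.of_forall fun n => norm_pos_iff.2 (hc n)⟩)
      have h1 : Tendsto (fun n => Real.log (S n / r n)) atTop atTop := by
        refine ((hSlim.pos_mul_atTop hβpos hcinv).atTop_div_const Real.two_pi_pos).congr
          fun n => ?_
        have := norm_pos_iff.2 (hc n)
        have := Real.pi_pos
        field_simp
      refine (Real.tendsto_exp_atTop.comp h1).congr fun n => ?_
      exact Real.exp_log (div_pos ((hr n).1.trans (hS n).1) (hr n).1)
    obtain ⟨B, ρ, hρ, hB⟩ := exists_mass_pushforward_cos_modelAt_sub_le hδ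
    -- The finitely many discarded indices are those where `b n` may be near a critical point, `S n`
    -- may be too large, or the push-forward may vanish.
    have hev := (hb.and (hS0.eventually_le_const hρ)).and (hpush.eventually_ne hβ0)
    obtain ⟨N, hN⟩ := eventually_atTop.1 hev
    have hbN : ∀ n, ∀ k : ℤ, δ ≤ ‖b (n + N) - (k : ℂ) * (Real.pi : ℂ)‖ :=
      fun n => (hN (n + N) (Nat.le_add_left _ _)).1.1
    have hsin : ∀ n, 0 < ‖Complex.sin (b (n + N))‖ := fun n =>
      lt_of_lt_of_le (by have := Real.pi_pos; positivity)
        (le_norm_sin_of_forall_le_norm_sub hδ.le (hbN n))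
    have hshift := tendsto_add_atTop_nat N
    have hpm := fun n => aestronglyMeasurable_pushforward_cos (hq n) (hfin n)
    refine ⟨N, fun n => hpm _, fun n => ⟨?_, ?_⟩, ⟨β, hβ, hpush.comp hshift⟩, fun n => ⟨?_, ?_⟩,
      fun n => c (n + N), fun n => hc _, ?_, ?_⟩
    · exact pos_iff_ne_zero.2 (hN (n + N) (Nat.le_add_left _ _)).2
    · exact (mass_pushforward_cos_le (hq _)).trans_lt (hfin _)
    · exact mul_pos (hsin n) (hr _).1
    · exact mul_lt_mul_of_pos_left (hS _).1 (hsin n)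
    · refine (hSr.comp hshift).congr fun n => ?_
      exact (mul_div_mul_left _ _ (hsin n).ne').symm
    · simp_rw [mass_pullback_sub]
      have hmm : ∀ n T, AEStronglyMeasurable (modelAt (c n) (b n) (r n) T) volume := fun n T =>
        (measurable_modelAt _ _ _ _).aestronglyMeasurable
      have hmfin : ∀ n T, r n < T → mass (modelAt (c n) (b n) (r n) T) Set.univ < ⊤ :=
        fun n T hT => by rw [mass_modelAt _ _ (hr n).1 hT.le]; exact ENNReal.ofReal_lt_top
      -- The full and the shrunk model both have mass tending to `β`, and one restricts the other,
      -- so the part between `S n` and `R n` is negligible.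
      have hrest : Tendsto (fun n => mass (modelAt (c n) (b n) (r n) (R n) -
          modelAt (c n) (b n) (r n) (S n)) Set.univ) atTop (𝓝 0) := by
        have h1 := ENNReal.Tendsto.sub hm (ENNReal.tendsto_ofReal hSlim)
          (Or.inl ENNReal.coe_ne_top)
        rw [ENNReal.ofReal_coe_nnreal, tsub_self] at h1
        refine h1.congr fun n => ?_
        have hA := measurableSet_annulus (b n) (r n) (S n)
        rw [← indicator_annulus_modelAt (c n) (b n) le_rfl (hS n).2.le, ← Set.indicator_compl,
          mass_indicator hA.compl, ← mass_add_mass_compl _ hA,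
          mass_modelAt_annulus _ _ (hr n).1 (hS n).1.le le_rfl (hS n).2.le]
        exact ENNReal.add_sub_cancel_left ENNReal.ofReal_ne_top
      -- Three errors: `q` against the full model, the full against the shrunk model, and the
      -- push-forward of the latter against the target model, with the same coefficient.
      have hup : Tendsto (fun n => (mass (q n - modelAt (c n) (b n) (r n) (R n)) Set.univ +
          mass (modelAt (c n) (b n) (r n) (R n) - modelAt (c n) (b n) (r n) (S n)) Set.univ) +
            ENNReal.ofReal (‖c n‖ * B)) atTop (𝓝 0) := by
        have h1 := ENNReal.tendsto_ofReal (hc0.mul_const B)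
        rw [zero_mul, ENNReal.ofReal_zero] at h1
        simpa using (herr.add hrest).add h1
      refine tendsto_of_tendsto_of_tendsto_of_le_of_le tendsto_const_nhds (hup.comp hshift)
        (fun n => zero_le) fun n => ?_
      simp only [Function.comp_apply]
      set j := n + N with hj
      have hSj := (hS j).1
      have h1 := mass_pushforward_cos_sub_le (hq j) (hfin j) (hmm j (S j)) (hmfin j (S j) hSj)
      have h2 := hB (c j) (b j) (r j) (S j) (hbN n) (hr j).1 hSj
        (hN j (Nat.le_add_left _ _)).1.2
      have h3 := mass_add_le (p := modelAt (c j) (b j) (r j) (R j) - modelAt (c j) (b j) (r j) (S j))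
        ((hq j).sub (hmm j (R j))) Set.univ
      rw [sub_add_sub_cancel] at h3
      have h4 := mass_add_le (p := pushforward Complex.cos (modelAt (c j) (b j) (r j) (S j)) -
          modelAt (c j) (Complex.cos (b j)) (‖Complex.sin (b j)‖ * r j) (‖Complex.sin (b j)‖ * S j))
        ((hpm j).sub (aestronglyMeasurable_pushforward_cos (hmm j (S j)) (hmfin j (S j) hSj)))
        Set.univ
      rw [sub_add_sub_cancel] at h4
      exact h4.trans (add_le_add (h1.trans h3) h2)
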